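/- **Theorem (equivalence of joint and sequential query design, known error probabilities).** Let $d\ge 1$, let $\mathcal X\subseteq\mathbb R^d$ differ from its interior by a Lebesgue null set, and let the target $X^*$ have a prior density $p_0$ supported in $\mathcal X$ with finite differential entropy, $H(p)=-\int p\log_2 p$. In each cycle $n=0,1,2,\dots$ each of $M$ players is asked one question "is $X^*\in A$?". Admissible questions to player $m$ in cycle $n$ are the sets $A$ that are unions of at most $J_n^{(m)}$ half-open rectangles $\prod_{l=1}^d[a_l,b_l)\subseteq\mathcal X$. Given $X^*$, all past answers and the question, player $m$ gives the correct binary answer with probability $1-\epsilon_m$ and the wrong one with probability $\epsilon_m$, where $\epsilon_m\in(0,1/2)$, and the answers are conditionally independent. In a *joint* policy the batch $\mathbf A_n=(A_n^{(1)},\dots,A_n^{(M)})$ is a function of the answers of the cycles before $n$; in a *sequential* policy the question to player $m$ may depend also on the answers of players $1,\dots,m-1$ in cycle $n$. Let $p_n$ be the posterior density of $X^*$ (computed by Bayes' rule) given the answers of the cycles before $n$, and let the expected entropy loss of cycle $n$ be $H(p_n)-\mathbb E[H(p_{n+1})\mid \text{answers before cycle } n]$. Put $$C=\sum_{m=1}^M\bigl(1-h_b(\epsilon_m)\bigr),\qquad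 h_b(\epsilon)=-\epsilon\log_2\epsilon-(1-\epsilon)\log_2(1-\epsilon),$$ and let $\gamma(\mathbf A)=\{\bigcap_{m=1}^M (A^{(m)})^{i_m}: i\in\{0,1\}^M\}$, where $A^1=A$ and $A^0=A^c$. (a) Let the $J_n^{(m)}$ be arbitrary, and let $p_n$ be the posterior after any admissible (joint or sequential) past and any history of answers. Then $p_n$ is a density on $\mathcal X$ with finite entropy. Every admissible sequential bisection design for cycle $n$ (each question has probability exactly $1/2$ under the posterior current at the moment when it is asked) has expected entropy loss exactly $C$. Every admissible joint batch has expected entropy loss at most $C$, and if the loss is $C$, then each $R\in\gamma(\mathbf A)$ has posterior mass $\int_R p_n=2^{-M}$. (b) There are numbers $J_0(n)$ such that, whenever $J_n^{(m)}\ge J_0(n)$ for all $n$ and $m$, the following hold. 1. For every posterior $p_n$ as in (a), the maximal expected entropy loss of cycle $n$ over admissible joint batches and the maximal expected entropy loss over admissible sequential designs are both attained and both equal $C$. There is a sequential bisection design each of whose questions maximizes the expected entropy loss for the player asked, given the current posterior; and every admissible sequential design with this greedy optimality property has expected entropy loss $C$. 2. For every posterior $p_n$ as in (a), every jointly optimal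 batch $\mathbf A$ satisfies $\int_R p_n(x)\,dx=2^{-M}$ for all $R\in\gamma(\mathbf A)$. Moreover, if an admissible joint policy minimizes $\mathbb E[H(p_N)]$ among all admissible joint policies, then in every cycle $n<N$ and after every history its expected entropy loss is $C$ and its batch $\mathbf A_n$ satisfies $\int_R p_n(x)\,dx=2^{-M}$ for all $R\in\gamma(\mathbf A_n)$. -/

import Mathlib

open MeasureTheory

noncomputable section

namespace TwentyQuestions

variable {d M : ℕ}

/-! ### Queries -/

/-- The half-open rectangle `[a 1, b 1) × ⋯ × [a d, b d)`. -/
def rect (a b : Fin d → ℝ) : Set (Fin d → ℝ) :=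
  Set.univ.pi fun l => Set.Ico (a l) (b l)

/-- `A` is a union of at most `J` half-open rectangles contained in `𝒳` (degenerate, i.e. empty,
rectangles are allowed, so that fewer than `J` proper ones may occur). -/
def IsQueryRegion (𝒳 : Set (Fin d → ℝ)) (J : ℕ) (A : Set (Fin d → ℝ)) : Prop :=
  ∃ a b : Fin J → Fin d → ℝ,
    (∀ j, a j ≤ b j ∧ rect (a j) (b j) ⊆ 𝒳) ∧ A = ⋃ j, rect (a j) (b j)

/-- The cell `⋂ₘ (A m)^{i m}`, where `A^1 = A` and `A^0 = Aᶜ`. -/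
def cell (A : Fin M → Set (Fin d → ℝ)) (i : Fin M → Bool) : Set (Fin d → ℝ) :=
  ⋂ m, if i m = true then A m else (A m)ᶜ

/-- The dyadic partition generated by the queries `A 1, …, A M`. -/
def dyadicPartition (A : Fin M → Set (Fin d → ℝ)) : Set (Set (Fin d → ℝ)) :=
  Set.range (cell A)

/-- A query design for one cycle of `M` questions: the region asked to player `t` is a function of
the answers of the players `s < t` in this cycle. -/
abbrev SeqDesign (d M : ℕ) : Type :=
  (t : Fin M) → (Fin t → Bool) → Set (Fin d → ℝ)

/-- A batch of `M` queries fixed at the start of the cycle, i.e. a design that ignores the answers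
given within the cycle. -/
def ofJoint (A : Fin M → Set (Fin d → ℝ)) : SeqDesign d M := fun t _ => A t

/-! ### Densities and entropy (in bits) -/

/-- `p` is a probability density on `ℝ^d` that is supported in `𝒳`. -/
structure IsDensityOn (𝒳 : Set (Fin d → ℝ)) (p : (Fin d → ℝ) → ℝ) : Prop where
  nonneg : ∀ x, 0 ≤ p x
  support : ∀ x, x ∉ 𝒳 → p x = 0
  integrable : Integrable p
  integral_eq_one : ∫ x, p x = 1

/-- Differential entropy `H(p) = -∫ p log₂ p`. -/
def entropy (p : (Fin d → ℝ) → ℝ) : ℝ := -∫ x, p x * Real.logb 2 (p x)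

/-- The integral that defines `H(p)` converges absolutely. -/
def HasFiniteEntropy (p : (Fin d → ℝ) → ℝ) : Prop :=
  Integrable fun x => p x * Real.logb 2 (p x)

/-- The probability `∫_R p`. -/
def mass (p : (Fin d → ℝ) → ℝ) (R : Set (Fin d → ℝ)) : ℝ := ∫ x in R, p x

/-- Capacity `1 - h_b(ε)` (in bits) of the binary symmetric channel with crossover probability
`ε`. -/
def capacity (ε : ℝ) : ℝ := 1 - Real.binEntropy ε / Real.log 2

/-! ### The response model -/

open Classical in
/-- Probability that a player behind a binary symmetric channel with crossover probability `ε`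
answers `y` to the question "is the target in `A`?" when the target is at `x`. -/
def bsc (ε : ℝ) (A : Set (Fin d → ℝ)) (x : Fin d → ℝ) (y : Bool) : ℝ :=
  if (y = true ↔ x ∈ A) then 1 - ε else ε

/-- Probability that the first `t` players of the cycle answer `w`, given that the target is at `x`
(and given everything before the cycle). The responses are conditionally independent: each factor
is the channel of one player, applied to the query this player is asked. -/
def prefixLik (ε : Fin M → ℝ) (D : SeqDesign d M) (t : ℕ) (ht : t ≤ M) (w : Fin t → Bool)
    (x : Fin d → ℝ) : ℝ :=
  ∏ s : Fin t, bsc (ε (Fin.castLE ht s))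
    (D (Fin.castLE ht s) fun r => w (Fin.castLE s.isLt.le r)) x (w s)

/-- Probability of an observation with likelihood `L` when the target has density `p`. -/
def evidence (p L : (Fin d → ℝ) → ℝ) : ℝ := ∫ x, L x * p x

/-- Bayes' rule: the posterior density after an observation with likelihood `L`. -/
def bayes (p L : (Fin d → ℝ) → ℝ) : (Fin d → ℝ) → ℝ := fun x => L x * p x / evidence p L

/-- Likelihood of the full vector `y` of the `M` answers of one cycle. -/
def cycleLik (ε : Fin M → ℝ) (D : SeqDesign d M) (y : Fin M → Bool) : (Fin d → ℝ) → ℝ :=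
  prefixLik ε D M le_rfl y

/-- The expected entropy loss `H(p) - 𝔼[H(p⁺)]` over one cycle that starts from the density `p` and
uses the design `D`; `p⁺` is the posterior at the end of the cycle. -/
def cycleLoss (ε : Fin M → ℝ) (p : (Fin d → ℝ) → ℝ) (D : SeqDesign d M) : ℝ :=
  entropy p -
    ∑ y : Fin M → Bool, evidence p (cycleLik ε D y) * entropy (bayes p (cycleLik ε D y))

/-- The posterior within the cycle, just before player `t` is queried, given the answers `w` of the
players `s < t`. -/
def subPosterior (ε : Fin M → ℝ) (p : (Fin d → ℝ) → ℝ) (D : SeqDesign d M) (t : Fin M)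
    (w : Fin t → Bool) : (Fin d → ℝ) → ℝ :=
  bayes p (prefixLik ε D t t.isLt.le w)

/-- Each query of the cycle bisects the current posterior. -/
def IsBisection (ε : Fin M → ℝ) (p : (Fin d → ℝ) → ℝ) (D : SeqDesign d M) : Prop :=
  ∀ (t : Fin M) (w : Fin t → Bool), mass (subPosterior ε p D t w) (D t w) = 1 / 2

/-- Expected entropy loss of a single query `A` to a single player. -/
def singleLoss (ε : ℝ) (p : (Fin d → ℝ) → ℝ) (A : Set (Fin d → ℝ)) : ℝ :=
  cycleLoss (M := 1) (fun _ => ε) p (ofJoint fun _ => A)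

/-- `D` is admissible for a cycle in which player `m` may be asked about unions of at most `J m`
rectangles. -/
def SeqDesign.Admissible (𝒳 : Set (Fin d → ℝ)) (J : Fin M → ℕ) (D : SeqDesign d M) : Prop :=
  ∀ t w, IsQueryRegion 𝒳 (J t) (D t w)

/-- Coordinate-by-coordinate design: each player in turn is asked an admissible query that is
optimal for this player alone, given the current posterior. -/
def IsGreedy (𝒳 : Set (Fin d → ℝ)) (J : Fin M → ℕ) (ε : Fin M → ℝ) (p : (Fin d → ℝ) → ℝ)
    (D : SeqDesign d M) : Prop :=
  D.Admissible 𝒳 J ∧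
    ∀ (t : Fin M) (w : Fin t → Bool) (A : Set (Fin d → ℝ)), IsQueryRegion 𝒳 (J t) A →
      singleLoss (ε t) (subPosterior ε p D t w) A ≤
        singleLoss (ε t) (subPosterior ε p D t w) (D t w)

/-! ### Policies over several cycles -/

/-- The answers of the `M` players in the first `n` cycles. -/
abbrev History (M n : ℕ) : Type := Fin n → Fin M → Bool

/-- A sequential policy: in cycle `n`, after the history `h`, it uses the design `σ n h`. -/
abbrev SeqPolicy (d M : ℕ) : Type := (n : ℕ) → History M n → SeqDesign d M

/-- A joint policy: in cycle `n`, after the history `h`, it asks the batch `ζ n h` of queries. -/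
abbrev JointPolicy (d M : ℕ) : Type := (n : ℕ) → History M n → Fin M → Set (Fin d → ℝ)

/-- A joint policy regarded as a sequential one. -/
def JointPolicy.toSeq (ζ : JointPolicy d M) : SeqPolicy d M := fun n h => ofJoint (ζ n h)

/-- All queries are unions of at most `J n m` rectangles in `𝒳`. -/
def SeqPolicy.Admissible (𝒳 : Set (Fin d → ℝ)) (J : ℕ → Fin M → ℕ) (σ : SeqPolicy d M) : Prop :=
  ∀ n h, (σ n h).Admissible 𝒳 (J n)

/-- All queries are unions of at most `J n m` rectangles in `𝒳`. -/
def JointPolicy.Admissible (𝒳 : Set (Fin d → ℝ)) (J : ℕ → Fin M → ℕ) (ζ : JointPolicy d M) :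
    Prop :=
  ∀ n h m, IsQueryRegion 𝒳 (J n m) (ζ n h m)

/-- The posterior density `p_n` of the target given the history of the first `n` cycles. -/
def posterior (ε : Fin M → ℝ) (p₀ : (Fin d → ℝ) → ℝ) (σ : SeqPolicy d M) :
    (n : ℕ) → History M n → (Fin d → ℝ) → ℝ
  | 0, _ => p₀
  | n + 1, h =>
      bayes (posterior ε p₀ σ n (Fin.init h)) (cycleLik ε (σ n (Fin.init h)) (h (Fin.last n)))

/-- The probability that the history `h` of the first `n` cycles occurs. -/
def historyProb (ε : Fin M → ℝ) (p₀ : (Fin d → ℝ) → ℝ) (σ : SeqPolicy d M) :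
    (n : ℕ) → History M n → ℝ
  | 0, _ => 1
  | n + 1, h =>
      historyProb ε p₀ σ n (Fin.init h) *
        evidence (posterior ε p₀ σ n (Fin.init h))
          (cycleLik ε (σ n (Fin.init h)) (h (Fin.last n)))

/-- The expected entropy `𝔼^σ[H(p_N)]` of the posterior after `N` cycles. -/
def expectedEntropy (ε : Fin M → ℝ) (p₀ : (Fin d → ℝ) → ℝ) (σ : SeqPolicy d M) (N : ℕ) : ℝ :=
  ∑ h : History M N, historyProb ε p₀ σ N h * entropy (posterior ε p₀ σ N h)

/-- `ζ` minimizes the expected entropy after `N` cycles among all admissible joint policies. -/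
def IsOptimalJointPolicy (𝒳 : Set (Fin d → ℝ)) (J : ℕ → Fin M → ℕ) (ε : Fin M → ℝ)
    (p₀ : (Fin d → ℝ) → ℝ) (N : ℕ) (ζ : JointPolicy d M) : Prop :=
  ζ.Admissible 𝒳 J ∧
    ∀ ζ' : JointPolicy d M, ζ'.Admissible 𝒳 J →
      expectedEntropy ε p₀ ζ.toSeq N ≤ expectedEntropy ε p₀ ζ'.toSeq N

/-- The batch `A` is admissible and maximizes the expected entropy loss of a cycle that starts from
the density `p` among all admissible batches. -/
def IsOptimalBatch (𝒳 : Set (Fin d → ℝ)) (J : Fin M → ℕ) (ε : Fin M → ℝ) (p : (Fin d → ℝ) → ℝ)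
    (A : Fin M → Set (Fin d → ℝ)) : Prop :=
  (∀ m, IsQueryRegion 𝒳 (J m) (A m)) ∧
    ∀ A' : Fin M → Set (Fin d → ℝ), (∀ m, IsQueryRegion 𝒳 (J m) (A' m)) →
      cycleLoss ε p (ofJoint A') ≤ cycleLoss ε p (ofJoint A)

end TwentyQuestions

end

/-! The likelihood of the answers to a cycle of queries has the entropy `∑ m, h_b (ε m)` at every
position of the target. By the symmetry of mutual information the expected entropy loss is therefore
the entropy of the answer vector minus this constant: it is at most `C`, with equality iff the
answers are uniform on `{0, 1}^M`. Read off on prefixes of the answer vector, uniformity says that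
every query bisects the posterior current when it is asked. For a joint batch, passing from one
vector of error probabilities to another amounts to a product of (possibly signed) binary symmetric
channels, which preserve the uniform law; for noiseless players the answers name the cell of the
target, so uniformity says that all cells have mass `2⁻¹ ^ M`.

Since errors are bounded away from `0` and `1`, all posteriors of a given cycle are bounded by one
multiple of the prior. Hence a single finite union `Q` of rectangles carries at least `1 - 2⁻¹ ^ M`
of the mass of each of them, and parallel hyperplanes cut `Q` into slabs of any prescribed masses,
from which bisecting queries and equalizing batches are assembled. -/

noncomputable section

namespace TwentyQuestions

section Likelihood

/-! ### Entropy of a finite distribution -/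

section ShannonEntropy

variable {ι : Type*} [Fintype ι] {e : ι → ℝ}

/-- Shannon entropy (in bits) of the distribution `e` on a finite type. -/
def shannonEntropy (e : ι → ℝ) : ℝ := -∑ i, e i * Real.logb 2 (e i)

/-- The deficit is the relative entropy with respect to the uniform law. -/
lemma logb_card_sub_shannonEntropy (hsum : ∑ i, e i = 1) :
    Real.logb 2 (Fintype.card ι) - shannonEntropy e =
      (∑ i, InformationTheory.klFun (Fintype.card ι * e i)) / (Fintype.card ι * Real.log 2) := by
  have hι : Nonempty ι := by
    by_contra h
    simp [not_nonempty_iff.1 h] at hsum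
  have hcard : (Fintype.card ι : ℝ) ≠ 0 := Nat.cast_ne_zero.2 Fintype.card_ne_zero
  have hlog : Real.log 2 ≠ 0 := (Real.log_pos one_lt_two).ne'
  have hterm (i : ι) : InformationTheory.klFun (Fintype.card ι * e i) =
      Fintype.card ι * Real.log (Fintype.card ι) * e i +
        Fintype.card ι * Real.log 2 * (e i * Real.logb 2 (e i)) + (1 - Fintype.card ι * e i) := by
    rw [InformationTheory.klFun_apply, Real.logb]
    rcases eq_or_ne (e i) 0 with hi | hi
    · simp [hi]
    · rw [Real.log_mul hcard hi]
      field_simp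
      ring
  simp only [hterm, Finset.sum_sub_distrib, Finset.sum_add_distrib, ← Finset.mul_sum, hsum,
    Finset.sum_const, Finset.card_univ, nsmul_eq_mul, shannonEntropy, Real.logb]
  field_simp
  ring

lemma shannonEntropy_le_logb_card (h0 : ∀ i, 0 ≤ e i) (hsum : ∑ i, e i = 1) :
    shannonEntropy e ≤ Real.logb 2 (Fintype.card ι) := by
  rw [← sub_nonneg, logb_card_sub_shannonEntropy hsum]
  have hlog : 0 ≤ Real.log 2 := (Real.log_pos one_lt_two).le
  exact div_nonneg (Finset.sum_nonneg fun i _ => InformationTheory.klFun_nonneg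
    (mul_nonneg (Nat.cast_nonneg _) (h0 i))) (mul_nonneg (Nat.cast_nonneg _) hlog)

lemma shannonEntropy_eq_logb_card_iff (h0 : ∀ i, 0 ≤ e i) (hsum : ∑ i, e i = 1) :
    shannonEntropy e = Real.logb 2 (Fintype.card ι) ↔ ∀ i, e i = (Fintype.card ι : ℝ)⁻¹ := by
  have hlog : Real.log 2 ≠ 0 := (Real.log_pos one_lt_two).ne'
  have hnonneg (i : ι) : 0 ≤ Fintype.card ι * e i := mul_nonneg (Nat.cast_nonneg _) (h0 i)
  have hcard (i : ι) : (Fintype.card ι : ℝ) ≠ 0 :=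
    Nat.cast_ne_zero.2 (Fintype.card_pos_iff.2 ⟨i⟩).ne'
  have hdenom : (Fintype.card ι : ℝ) * Real.log 2 ≠ 0 := by
    refine mul_ne_zero (fun h => ?_) hlog
    have : IsEmpty ι := Fintype.card_eq_zero_iff.1 (Nat.cast_eq_zero.1 h)
    simp at hsum
  rw [eq_comm, ← sub_eq_zero, logb_card_sub_shannonEntropy hsum, div_eq_zero_iff,
    or_iff_left hdenom,
    Finset.sum_eq_zero_iff_of_nonneg fun i _ => InformationTheory.klFun_nonneg (hnonneg i)]
  simp only [Finset.mem_univ, true_imp_iff, InformationTheory.klFun_eq_zero_iff (hnonneg _)]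
  exact forall_congr' fun i => by rw [mul_comm, mul_eq_one_iff_eq_inv₀ (hcard i)]

end ShannonEntropy

variable {d : ℕ} {𝒳 : Set (Fin d → ℝ)} {p L L₁ L₂ : (Fin d → ℝ) → ℝ} {c : ℝ}

/-! ### Likelihoods and Bayes' rule -/

/-- A measurable likelihood of an observation, with values in `[c, 1]` for some `c > 0`: no
observation can rule out a position of the target. -/
structure IsLikelihood (c : ℝ) (L : (Fin d → ℝ) → ℝ) : Prop where
  measurable : Measurable L
  pos : 0 < c
  le : ∀ x, c ≤ L x
  le_one : ∀ x, L x ≤ 1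

namespace IsLikelihood

lemma apply_pos (hL : IsLikelihood c L) (x : Fin d → ℝ) : 0 < L x :=
  hL.pos.trans_le (hL.le x)

lemma integrable_mul (hL : IsLikelihood c L) {f : (Fin d → ℝ) → ℝ} (hf : Integrable f) :
    Integrable fun x => L x * f x :=
  hf.bdd_mul (c := 1) hL.measurable.aestronglyMeasurable <| .of_forall fun x => by
    rw [Real.norm_of_nonneg (hL.apply_pos x).le]
    exact hL.le_one x

lemma integrable_mul_logb (hL : IsLikelihood c L) {f : (Fin d → ℝ) → ℝ} (hf : Integrable f) :
    Integrable fun x => L x * Real.logb 2 (L x) * f x := by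
  have hmeas : Measurable fun x => L x * Real.logb 2 (L x) :=
    hL.measurable.mul (hL.measurable.log.div_const _)
  refine hf.bdd_mul (c := -Real.logb 2 c) hmeas.aestronglyMeasurable (.of_forall fun x => ?_)
  have hpos := hL.apply_pos x
  have hlog : Real.logb 2 (L x) ≤ 0 := Real.logb_nonpos one_lt_two hpos.le (hL.le_one x)
  calc ‖L x * Real.logb 2 (L x)‖ = L x * -Real.logb 2 (L x) := by
        rw [norm_mul, Real.norm_of_nonneg hpos.le, Real.norm_of_nonpos hlog]
    _ ≤ -Real.logb 2 (L x) := mul_le_of_le_one_left (neg_nonneg.2 hlog) (hL.le_one x)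
    _ ≤ -Real.logb 2 c := neg_le_neg (Real.logb_le_logb_of_le one_lt_two hL.pos (hL.le x))

lemma le_evidence (hL : IsLikelihood c L) (hp : IsDensityOn 𝒳 p) : c ≤ evidence p L :=
  calc c = ∫ x, c * p x := by rw [integral_const_mul, hp.integral_eq_one, mul_one]
    _ ≤ evidence p L := integral_mono (hp.integrable.const_mul c) (hL.integrable_mul hp.integrable)
        fun x => mul_le_mul_of_nonneg_right (hL.le x) (hp.nonneg x)

lemma evidence_pos (hL : IsLikelihood c L) (hp : IsDensityOn 𝒳 p) : 0 < evidence p L :=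
  hL.pos.trans_le (hL.le_evidence hp)

lemma bayes_le (hL : IsLikelihood c L) (hp : IsDensityOn 𝒳 p) (x : Fin d → ℝ) :
    bayes p L x ≤ c⁻¹ * p x :=
  calc L x * p x / evidence p L ≤ 1 * p x / c := by
        gcongr
        exacts [mul_nonneg zero_le_one (hp.nonneg x), hL.pos, hp.nonneg x, hL.le_one x,
          hL.le_evidence hp]
    _ = c⁻¹ * p x := by rw [one_mul, div_eq_inv_mul]

lemma isDensityOn_bayes (hL : IsLikelihood c L) (hp : IsDensityOn 𝒳 p) :
    IsDensityOn 𝒳 (bayes p L) where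
  nonneg x := div_nonneg (mul_nonneg (hL.apply_pos x).le (hp.nonneg x)) (hL.evidence_pos hp).le
  support x hx := by rw [bayes, hp.support x hx, mul_zero, zero_div]
  integrable := (hL.integrable_mul hp.integrable).div_const _
  integral_eq_one := by
    simp only [bayes]
    rw [integral_div]
    exact div_self (hL.evidence_pos hp).ne'

lemma evidence_mul_bayes_mul_logb (hL : IsLikelihood c L) (hp : IsDensityOn 𝒳 p)
    (x : Fin d → ℝ) :
    evidence p L * (bayes p L x * Real.logb 2 (bayes p L x)) =
      L x * (p x * Real.logb 2 (p x)) + L x * Real.logb 2 (L x) * p x -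
        Real.logb 2 (evidence p L) * (L x * p x) := by
  have he := (hL.evidence_pos hp).ne'
  have hx := (hL.apply_pos x).ne'
  rcases eq_or_ne (p x) 0 with hpx | hpx
  · simp [bayes, hpx]
  · rw [bayes, Real.logb_div (mul_ne_zero hx hpx) he, Real.logb_mul hx hpx]
    field_simp
    ring

lemma hasFiniteEntropy_bayes (hL : IsLikelihood c L) (hp : IsDensityOn 𝒳 p)
    (hH : HasFiniteEntropy p) : HasFiniteEntropy (bayes p L) := by
  have hint := ((hL.integrable_mul hH).add (hL.integrable_mul_logb hp.integrable)).sub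
    ((hL.integrable_mul hp.integrable).const_mul (Real.logb 2 (evidence p L)))
  refine (hint.const_mul (evidence p L)⁻¹).congr (.of_forall fun x => ?_)
  simp only [Pi.add_apply, Pi.sub_apply]
  rw [← hL.evidence_mul_bayes_mul_logb hp x, inv_mul_cancel_left₀ (hL.evidence_pos hp).ne']

lemma evidence_mul_entropy_bayes (hL : IsLikelihood c L) (hp : IsDensityOn 𝒳 p)
    (hH : HasFiniteEntropy p) :
    evidence p L * entropy (bayes p L) =
      evidence p L * Real.logb 2 (evidence p L) - (∫ x, L x * (p x * Real.logb 2 (p x))) -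
        ∫ x, L x * Real.logb 2 (L x) * p x := by
  have hprior := hL.integrable_mul hH
  have hlik := hL.integrable_mul_logb hp.integrable
  have hsum : Integrable fun x =>
      L x * (p x * Real.logb 2 (p x)) + L x * Real.logb 2 (L x) * p x := hprior.add hlik
  have hev := (hL.integrable_mul hp.integrable).const_mul (Real.logb 2 (evidence p L))
  rw [entropy, mul_neg, ← integral_const_mul]
  simp only [hL.evidence_mul_bayes_mul_logb hp]
  rw [integral_sub hsum hev, integral_add hprior hlik, integral_const_mul]
  simp only [evidence]
  ring

end IsLikelihood

lemma evidence_mul (he : evidence p L₁ ≠ 0) :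
    evidence p (fun x => L₁ x * L₂ x) = evidence p L₁ * evidence (bayes p L₁) L₂ := by
  rw [evidence, evidence.eq_def (bayes p L₁), ← integral_const_mul]
  congr 1 with x
  rw [bayes]
  field_simp

namespace IsDensityOn

lemma evidence_one (hp : IsDensityOn 𝒳 p) : evidence p (fun _ => 1) = 1 := by
  simp only [evidence, one_mul, hp.integral_eq_one]

lemma bayes_one (hp : IsDensityOn 𝒳 p) : bayes p (fun _ => 1) = p := by
  funext x
  rw [bayes, hp.evidence_one, one_mul, div_one]

variable {ι : Type*} [Fintype ι] {L : ι → (Fin d → ℝ) → ℝ}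

lemma sum_evidence (hp : IsDensityOn 𝒳 p) (hL : ∀ i, IsLikelihood c (L i))
    (hsum : ∀ x, ∑ i, L i x = 1) : ∑ i, evidence p (L i) = 1 := by
  simp only [evidence]
  rw [← integral_finsetSum _ fun i _ => (hL i).integrable_mul hp.integrable]
  simp only [← Finset.sum_mul, hsum, one_mul, hp.integral_eq_one]

/-- Mutual information is symmetric: what an observation tells about the target is its own entropy
minus its conditional entropy given the target. -/
lemma entropy_sub_sum_entropy_bayes (hp : IsDensityOn 𝒳 p) (hH : HasFiniteEntropy p)
    (hL : ∀ i, IsLikelihood c (L i)) (hsum : ∀ x, ∑ i, L i x = 1) :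
    entropy p - ∑ i, evidence p (L i) * entropy (bayes p (L i)) =
      shannonEntropy (fun i => evidence p (L i)) -
        ∫ x, shannonEntropy (fun i => L i x) * p x := by
  have hprior : ∑ i, ∫ x, L i x * (p x * Real.logb 2 (p x)) = -entropy p := by
    rw [← integral_finsetSum _ fun i _ => (hL i).integrable_mul hH]
    simp only [← Finset.sum_mul, hsum, one_mul, entropy, neg_neg]
  have hcond : ∑ i, ∫ x, L i x * Real.logb 2 (L i x) * p x =
      -∫ x, shannonEntropy (fun i => L i x) * p x := by
    rw [← integral_finsetSum _ fun i _ => (hL i).integrable_mul_logb hp.integrable, ← integral_neg]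
    simp only [shannonEntropy, neg_mul, neg_neg, Finset.sum_mul]
  simp only [(hL _).evidence_mul_entropy_bayes hp hH, Finset.sum_sub_distrib, hprior, hcond]
  rw [shannonEntropy]
  ring

end IsDensityOn

end Likelihood

section Cycle

variable {d : ℕ} {𝒳 : Set (Fin d → ℝ)} {p : (Fin d → ℝ) → ℝ}

/-! ### The binary symmetric channel -/

section Channel

variable {ε : ℝ} {A : Set (Fin d → ℝ)}

lemma bsc_eq_half_add (ε : ℝ) (A : Set (Fin d → ℝ)) (x : Fin d → ℝ) (y : Bool) :
    bsc ε A x y =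
      1 / 2 + (if y then 1 else -1) * (1 - 2 * ε) * (A.indicator (fun _ => 1) x - 1 / 2) := by
  by_cases hx : x ∈ A <;> cases y <;> simp [bsc, hx] <;> ring

lemma sum_bsc (ε : ℝ) (A : Set (Fin d → ℝ)) (x : Fin d → ℝ) : ∑ y, bsc ε A x y = 1 := by
  rw [Fintype.sum_bool, bsc_eq_half_add, bsc_eq_half_add]
  simp
  ring

lemma measurable_bsc (hA : MeasurableSet A) (y : Bool) : Measurable fun x => bsc ε A x y := by
  simp only [bsc_eq_half_add]
  exact measurable_const.add (((measurable_const.indicator hA).sub_const _).const_mul _)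

lemma bsc_mem_Icc (ε : ℝ) (A : Set (Fin d → ℝ)) (x : Fin d → ℝ) (y : Bool) :
    bsc ε A x y ∈ Set.Icc (min ε (1 - ε)) (max ε (1 - ε)) := by
  unfold bsc
  split_ifs <;> simp

lemma shannonEntropy_bsc (ε : ℝ) (A : Set (Fin d → ℝ)) (x : Fin d → ℝ) :
    shannonEntropy (bsc ε A x) = Real.binEntropy ε / Real.log 2 := by
  rw [shannonEntropy, Fintype.sum_bool]
  by_cases hx : x ∈ A <;> simp [bsc, hx, Real.binEntropy, Real.logb] <;> ring

lemma evidence_bsc (hA : MeasurableSet A) (hp : IsDensityOn 𝒳 p) (y : Bool) :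
    evidence p (fun x => bsc ε A x y) =
      1 / 2 + (if y then 1 else -1) * (1 - 2 * ε) * (mass p A - 1 / 2) := by
  set k : ℝ := (if y then 1 else -1) * (1 - 2 * ε)
  have hpoint (x : Fin d → ℝ) :
      bsc ε A x y * p x = (1 / 2 - k / 2) * p x + k * A.indicator p x := by
    rw [bsc_eq_half_add]
    by_cases hx : x ∈ A
    · rw [Set.indicator_of_mem hx, Set.indicator_of_mem hx]
      ring
    · rw [Set.indicator_of_notMem hx, Set.indicator_of_notMem hx]
      ring
  simp only [evidence, hpoint]
  rw [integral_add (hp.integrable.const_mul _) ((hp.integrable.indicator hA).const_mul _),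
    integral_const_mul, integral_const_mul, integral_indicator hA, hp.integral_eq_one, mass]
  ring

lemma evidence_bsc_of_mass_eq_half (hA : MeasurableSet A) (hp : IsDensityOn 𝒳 p)
    (hmass : mass p A = 1 / 2) (y : Bool) : evidence p (fun x => bsc ε A x y) = 1 / 2 := by
  rw [evidence_bsc hA hp, hmass, sub_self, mul_zero, add_zero]

lemma mass_eq_half_of_evidence_bsc (hε : ε ≠ 1 / 2) (hA : MeasurableSet A)
    (hp : IsDensityOn 𝒳 p) {y : Bool} (h : evidence p (fun x => bsc ε A x y) = 1 / 2) :
    mass p A = 1 / 2 := by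
  rw [evidence_bsc hA hp, add_eq_left] at h
  refine sub_eq_zero.1 ((mul_eq_zero.1 h).resolve_left (mul_ne_zero ?_ ?_))
  · cases y <;> norm_num
  · exact fun h => hε (by linarith)

end Channel

variable {M : ℕ} {ε ε' : Fin M → ℝ} {D : SeqDesign d M} {A : Fin M → Set (Fin d → ℝ)}

/-! ### The answers of one cycle -/

section SnocSums

variable {α : Type*} [Fintype α] {n : ℕ}

lemma sum_eq_sum_snoc (f : (Fin (n + 1) → α) → ℝ) :
    ∑ w, f w = ∑ v : Fin n → α, ∑ y, f (Fin.snoc v y) := by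
  rw [Finset.sum_comm, ← Fintype.sum_prod_type']
  exact (Fintype.sum_equiv (Fin.snocEquiv fun _ : Fin (n + 1) => α) _ _ fun _ => rfl).symm

lemma shannonEntropy_snoc {e : (Fin (n + 1) → α) → ℝ} {q : (Fin n → α) → ℝ}
    {r : (Fin n → α) → α → ℝ} (he : ∀ w y, e (Fin.snoc w y) = q w * r w y)
    (hr : ∀ w, ∑ y, r w y = 1) :
    shannonEntropy e = shannonEntropy q + ∑ w, q w * shannonEntropy (r w) := by
  have hmul (a b : ℝ) : a * b * Real.logb 2 (a * b) =
      a * Real.logb 2 a * b + a * (b * Real.logb 2 b) := by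
    rcases eq_or_ne a 0 with rfl | ha
    · simp
    rcases eq_or_ne b 0 with rfl | hb
    · simp
    rw [Real.logb_mul ha hb]
    ring
  simp only [shannonEntropy, sum_eq_sum_snoc, he, hmul, Finset.sum_add_distrib, ← Finset.mul_sum,
    hr, mul_neg, mul_one, Finset.sum_neg_distrib]
  ring

end SnocSums

lemma prefixLik_zero (ε : Fin M → ℝ) (D : SeqDesign d M) (w : Fin 0 → Bool) :
    prefixLik ε D 0 (Nat.zero_le M) w = fun _ => 1 :=
  rfl

lemma prefixLik_snoc (ε : Fin M → ℝ) (D : SeqDesign d M) {t : ℕ} (ht : t + 1 ≤ M)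
    (w : Fin t → Bool) (y : Bool) :
    prefixLik ε D (t + 1) ht (Fin.snoc w y) = fun x =>
      prefixLik ε D t (t.le_succ.trans ht) w x * bsc (ε ⟨t, ht⟩) (D ⟨t, ht⟩ w) x y := by
  have hinit {s : ℕ} (hs : s ≤ t) :
      (fun r : Fin s => (Fin.snoc w y : Fin (t + 1) → Bool) (Fin.castLE (hs.trans t.le_succ) r)) =
        fun r => w (Fin.castLE hs r) :=
    funext fun r => Fin.snoc_castSucc (α := fun _ => Bool) y w (Fin.castLE hs r)
  funext x
  rw [prefixLik, Fin.prod_univ_castSucc, prefixLik]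
  congr 1
  · refine Finset.prod_congr rfl fun s _ => ?_
    rw [Fin.snoc_castSucc]
    exact congrArg (fun v => bsc (ε (Fin.castLE (t.le_succ.trans ht) s))
      (D (Fin.castLE (t.le_succ.trans ht) s) v) x (w s)) (hinit s.isLt.le)
  · rw [Fin.snoc_last]
    exact congrArg (fun v => bsc (ε ⟨t, ht⟩) (D ⟨t, ht⟩ v) x y) (hinit le_rfl)

lemma sum_prefixLik (ε : Fin M → ℝ) (D : SeqDesign d M) (t : ℕ) (ht : t ≤ M) (x : Fin d → ℝ) :
    ∑ w, prefixLik ε D t ht w x = 1 := by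
  induction t with
  | zero => simp [prefixLik_zero]
  | succ t ih => simp only [sum_eq_sum_snoc, prefixLik_snoc, ← Finset.mul_sum, sum_bsc, mul_one, ih]

lemma shannonEntropy_prefixLik (ε : Fin M → ℝ) (D : SeqDesign d M) (t : ℕ) (ht : t ≤ M)
    (x : Fin d → ℝ) :
    shannonEntropy (fun w => prefixLik ε D t ht w x) =
      ∑ s : Fin t, Real.binEntropy (ε (Fin.castLE ht s)) / Real.log 2 := by
  induction t with
  | zero => simp [prefixLik_zero, shannonEntropy]
  | succ t ih =>
    rw [shannonEntropy_snoc (fun w y => congrFun (prefixLik_snoc ε D ht w y) x)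
      fun w => sum_bsc _ _ x, ih (t.le_succ.trans ht), Fin.sum_univ_castSucc]
    simp only [shannonEntropy_bsc, ← Finset.sum_mul, sum_prefixLik, one_mul]
    rfl

/-- A design all of whose queries are measurable; unlike admissibility, this does not depend on `𝒳`
or on the bounds on the numbers of rectangles. -/
def SeqDesign.IsMeasurable (D : SeqDesign d M) : Prop :=
  ∀ t w, MeasurableSet (D t w)

lemma measurable_prefixLik (hD : D.IsMeasurable) (t : ℕ) (ht : t ≤ M) (w : Fin t → Bool) :
    Measurable (prefixLik ε D t ht w) :=
  Finset.measurable_fun_prod _ fun _ _ => measurable_bsc (hD _ _) _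

lemma prefixLik_mem_Icc (hε : ∀ m, ε m ∈ Set.Icc (0 : ℝ) 1) (t : ℕ) (ht : t ≤ M)
    (w : Fin t → Bool) (x : Fin d → ℝ) :
    prefixLik ε D t ht w x ∈ Set.Icc (0 : ℝ) 1 := by
  have hbsc (m : Fin M) (A : Set (Fin d → ℝ)) (y : Bool) :
      bsc (ε m) A x y ∈ Set.Icc (0 : ℝ) 1 :=
    Set.Icc_subset_Icc (le_min (hε m).1 (sub_nonneg.2 (hε m).2))
      (max_le (hε m).2 (sub_le_self _ (hε m).1)) (bsc_mem_Icc _ _ _ _)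
  exact ⟨Finset.prod_nonneg fun s _ => (hbsc _ _ _).1,
    Finset.prod_le_one (fun s _ => (hbsc _ _ _).1) fun s _ => (hbsc _ _ _).2⟩

/-- The smallest value of the likelihood of the answers of a cycle, uniformly in the design: every
player gives the less likely answer. -/
def minLik (ε : Fin M → ℝ) : ℝ := ∏ m, min (ε m) (1 - ε m)

lemma minLik_pos (hε : ∀ m, ε m ∈ Set.Ioo (0 : ℝ) 1) : 0 < minLik ε :=
  Finset.prod_pos fun m _ => lt_min (hε m).1 (sub_pos.2 (hε m).2)

lemma minLik_le_one (hε : ∀ m, ε m ∈ Set.Ioo (0 : ℝ) 1) : minLik ε ≤ 1 :=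
  Finset.prod_le_one (fun m _ => (lt_min (hε m).1 (sub_pos.2 (hε m).2)).le)
    fun m _ => min_le_of_left_le (hε m).2.le

lemma isLikelihood_prefixLik (hε : ∀ m, ε m ∈ Set.Ioo (0 : ℝ) 1) (hD : D.IsMeasurable) (t : ℕ)
    (ht : t ≤ M) (w : Fin t → Bool) : IsLikelihood (minLik ε) (prefixLik ε D t ht w) where
  measurable := measurable_prefixLik hD t ht w
  pos := minLik_pos hε
  le x := by
    have hmin (m : Fin M) : 0 ≤ min (ε m) (1 - ε m) :=
      (lt_min (hε m).1 (sub_pos.2 (hε m).2)).le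
    calc minLik ε ≤ ∏ m ∈ Finset.univ.map (Fin.castLEEmb ht), min (ε m) (1 - ε m) :=
          Finset.prod_le_prod_of_subset_of_le_one (Finset.subset_univ _) (fun m _ => hmin m)
            fun m _ _ => min_le_of_left_le (hε m).2.le
      _ ≤ prefixLik ε D t ht w x := by
          rw [Finset.prod_map]
          exact Finset.prod_le_prod (fun s _ => hmin _) fun s _ => (bsc_mem_Icc _ _ _ _).1
  le_one x := (prefixLik_mem_Icc (fun m => Set.Ioo_subset_Icc_self (hε m)) t ht w x).2

lemma isLikelihood_cycleLik (hε : ∀ m, ε m ∈ Set.Ioo (0 : ℝ) 1) (hD : D.IsMeasurable)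
    (y : Fin M → Bool) : IsLikelihood (minLik ε) (cycleLik ε D y) :=
  isLikelihood_prefixLik hε hD M le_rfl y

lemma sum_cycleLik (ε : Fin M → ℝ) (D : SeqDesign d M) (x : Fin d → ℝ) :
    ∑ y, cycleLik ε D y x = 1 :=
  sum_prefixLik ε D M le_rfl x

lemma shannonEntropy_cycleLik (ε : Fin M → ℝ) (D : SeqDesign d M) (x : Fin d → ℝ) :
    shannonEntropy (fun y => cycleLik ε D y x) = ∑ m, Real.binEntropy (ε m) / Real.log 2 :=
  shannonEntropy_prefixLik ε D M le_rfl x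

/-! ### The loss of one cycle -/

lemma evidence_cycleLik_nonneg (hε : ∀ m, ε m ∈ Set.Ioo (0 : ℝ) 1) (hD : D.IsMeasurable)
    (hp : IsDensityOn 𝒳 p) (y : Fin M → Bool) : 0 ≤ evidence p (cycleLik ε D y) :=
  ((isLikelihood_cycleLik hε hD y).evidence_pos hp).le

lemma sum_evidence_cycleLik (hε : ∀ m, ε m ∈ Set.Ioo (0 : ℝ) 1) (hD : D.IsMeasurable)
    (hp : IsDensityOn 𝒳 p) : ∑ y, evidence p (cycleLik ε D y) = 1 :=
  hp.sum_evidence (isLikelihood_cycleLik hε hD) (sum_cycleLik ε D)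

lemma cycleLoss_eq (hε : ∀ m, ε m ∈ Set.Ioo (0 : ℝ) 1) (hD : D.IsMeasurable)
    (hp : IsDensityOn 𝒳 p) (hH : HasFiniteEntropy p) :
    cycleLoss ε p D = shannonEntropy (fun y => evidence p (cycleLik ε D y)) -
      ∑ m, Real.binEntropy (ε m) / Real.log 2 := by
  rw [cycleLoss, hp.entropy_sub_sum_entropy_bayes hH (isLikelihood_cycleLik hε hD)
    (sum_cycleLik ε D)]
  simp only [shannonEntropy_cycleLik]
  rw [integral_const_mul, hp.integral_eq_one, mul_one]

lemma sum_capacity_eq (ε : Fin M → ℝ) :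
    ∑ m, capacity (ε m) =
      Real.logb 2 (Fintype.card (Fin M → Bool)) - ∑ m, Real.binEntropy (ε m) / Real.log 2 := by
  simp [capacity, Finset.sum_sub_distrib, Real.logb_pow]

lemma cycleLoss_le (hε : ∀ m, ε m ∈ Set.Ioo (0 : ℝ) 1) (hD : D.IsMeasurable)
    (hp : IsDensityOn 𝒳 p) (hH : HasFiniteEntropy p) :
    cycleLoss ε p D ≤ ∑ m, capacity (ε m) := by
  rw [cycleLoss_eq hε hD hp hH, sum_capacity_eq]
  exact sub_le_sub_right (shannonEntropy_le_logb_card (evidence_cycleLik_nonneg hε hD hp)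
    (sum_evidence_cycleLik hε hD hp)) _

lemma cycleLoss_eq_iff_evidence (hε : ∀ m, ε m ∈ Set.Ioo (0 : ℝ) 1) (hD : D.IsMeasurable)
    (hp : IsDensityOn 𝒳 p) (hH : HasFiniteEntropy p) :
    cycleLoss ε p D = ∑ m, capacity (ε m) ↔
      ∀ y, evidence p (cycleLik ε D y) = (2 : ℝ)⁻¹ ^ M := by
  rw [cycleLoss_eq hε hD hp hH, sum_capacity_eq, sub_left_inj, shannonEntropy_eq_logb_card_iff
    (evidence_cycleLik_nonneg hε hD hp) (sum_evidence_cycleLik hε hD hp)]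
  simp

lemma isDensityOn_subPosterior (hε : ∀ m, ε m ∈ Set.Ioo (0 : ℝ) 1) (hD : D.IsMeasurable)
    (hp : IsDensityOn 𝒳 p) (t : Fin M) (w : Fin t → Bool) :
    IsDensityOn 𝒳 (subPosterior ε p D t w) :=
  (isLikelihood_prefixLik hε hD t t.isLt.le w).isDensityOn_bayes hp

lemma hasFiniteEntropy_subPosterior (hε : ∀ m, ε m ∈ Set.Ioo (0 : ℝ) 1) (hD : D.IsMeasurable)
    (hp : IsDensityOn 𝒳 p) (hH : HasFiniteEntropy p) (t : Fin M) (w : Fin t → Bool) :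
    HasFiniteEntropy (subPosterior ε p D t w) :=
  (isLikelihood_prefixLik hε hD t t.isLt.le w).hasFiniteEntropy_bayes hp hH

lemma evidence_prefixLik_snoc (hε : ∀ m, ε m ∈ Set.Ioo (0 : ℝ) 1) (hD : D.IsMeasurable)
    (hp : IsDensityOn 𝒳 p) {t : ℕ} (ht : t + 1 ≤ M) (w : Fin t → Bool) (y : Bool) :
    evidence p (prefixLik ε D (t + 1) ht (Fin.snoc w y)) =
      evidence p (prefixLik ε D t (t.le_succ.trans ht) w) *
        evidence (subPosterior ε p D ⟨t, ht⟩ w) fun x => bsc (ε ⟨t, ht⟩) (D ⟨t, ht⟩ w) x y := by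
  rw [prefixLik_snoc,
    evidence_mul ((isLikelihood_prefixLik hε hD t (t.le_succ.trans ht) w).evidence_pos hp).ne']
  rfl

lemma sum_evidence_prefixLik_snoc (hε : ∀ m, ε m ∈ Set.Ioo (0 : ℝ) 1) (hD : D.IsMeasurable)
    (hp : IsDensityOn 𝒳 p) {t : ℕ} (ht : t + 1 ≤ M) (w : Fin t → Bool) :
    ∑ y, evidence p (prefixLik ε D (t + 1) ht (Fin.snoc w y)) =
      evidence p (prefixLik ε D t (t.le_succ.trans ht) w) := by
  simp only [evidence]
  rw [← integral_finsetSum _ fun y _ =>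
    (isLikelihood_prefixLik hε hD (t + 1) ht _).integrable_mul hp.integrable]
  simp only [prefixLik_snoc, ← Finset.sum_mul, ← Finset.mul_sum, sum_bsc, mul_one]

lemma evidence_prefixLik_of_evidence_cycleLik (hε : ∀ m, ε m ∈ Set.Ioo (0 : ℝ) 1)
    (hD : D.IsMeasurable) (hp : IsDensityOn 𝒳 p)
    (hunif : ∀ y, evidence p (cycleLik ε D y) = (2 : ℝ)⁻¹ ^ M) (t : ℕ) (ht : t ≤ M)
    (w : Fin t → Bool) : evidence p (prefixLik ε D t ht w) = (2 : ℝ)⁻¹ ^ t := by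
  induction ht using Nat.decreasingInduction with
  | self => exact hunif w
  | of_succ t ht ih =>
    simp only [← sum_evidence_prefixLik_snoc hε hD hp ht w, ih, Fintype.sum_bool]
    ring

lemma evidence_prefixLik_of_isBisection (hε : ∀ m, ε m ∈ Set.Ioo (0 : ℝ) 1)
    (hD : D.IsMeasurable) (hp : IsDensityOn 𝒳 p) (hB : IsBisection ε p D) (t : ℕ) (ht : t ≤ M)
    (w : Fin t → Bool) : evidence p (prefixLik ε D t ht w) = (2 : ℝ)⁻¹ ^ t := by
  induction t with
  | zero => rw [prefixLik_zero, hp.evidence_one, pow_zero]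
  | succ t ih =>
    rw [← Fin.snoc_init_self w, evidence_prefixLik_snoc hε hD hp ht, ih,
      evidence_bsc_of_mass_eq_half (hD _ _) (isDensityOn_subPosterior hε hD hp _ _)
        (hB ⟨t, ht⟩ (Fin.init w)), pow_succ, one_div]

lemma isBisection_of_evidence_cycleLik (hε : ∀ m, ε m ∈ Set.Ioo (0 : ℝ) 1)
    (hε' : ∀ m, ε m ≠ 1 / 2) (hD : D.IsMeasurable) (hp : IsDensityOn 𝒳 p)
    (hunif : ∀ y, evidence p (cycleLik ε D y) = (2 : ℝ)⁻¹ ^ M) : IsBisection ε p D := by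
  intro t w
  have hsnoc := evidence_prefixLik_snoc hε hD hp t.isLt w true
  simp only [evidence_prefixLik_of_evidence_cycleLik hε hD hp hunif, pow_succ] at hsnoc
  refine mass_eq_half_of_evidence_bsc (hε' t) (hD t w) (isDensityOn_subPosterior hε hD hp t w)
    (y := true) ?_
  rw [one_div]
  exact (mul_left_cancel₀ (by positivity) hsnoc).symm

lemma cycleLoss_eq_of_isBisection (hε : ∀ m, ε m ∈ Set.Ioo (0 : ℝ) 1) (hD : D.IsMeasurable)
    (hp : IsDensityOn 𝒳 p) (hH : HasFiniteEntropy p) (hB : IsBisection ε p D) :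
    cycleLoss ε p D = ∑ m, capacity (ε m) :=
  (cycleLoss_eq_iff_evidence hε hD hp hH).2
    (evidence_prefixLik_of_isBisection hε hD hp hB M le_rfl)

lemma isBisection_of_cycleLoss_eq (hε : ∀ m, ε m ∈ Set.Ioo (0 : ℝ) 1) (hε' : ∀ m, ε m ≠ 1 / 2)
    (hD : D.IsMeasurable) (hp : IsDensityOn 𝒳 p) (hH : HasFiniteEntropy p)
    (h : cycleLoss ε p D = ∑ m, capacity (ε m)) : IsBisection ε p D :=
  isBisection_of_evidence_cycleLik hε hε' hD hp ((cycleLoss_eq_iff_evidence hε hD hp hH).1 h)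

lemma isMeasurable_ofJoint (hA : ∀ m, MeasurableSet (A m)) : (ofJoint A).IsMeasurable :=
  fun m _ => hA m

/-! ### Single queries and greedy designs -/

section SingleQuery

variable {ε : ℝ} {A : Set (Fin d → ℝ)}

lemma isBisection_single_iff (hp : IsDensityOn 𝒳 p) :
    IsBisection (M := 1) (fun _ => ε) p (ofJoint fun _ => A) ↔ mass p A = 1 / 2 := by
  have hprior (w : Fin 0 → Bool) :
      subPosterior (M := 1) (fun _ => ε) p (ofJoint fun _ => A) 0 w = p :=
    hp.bayes_one
  refine ⟨fun h => hprior ![] ▸ h 0 ![], fun h t w => ?_⟩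
  obtain rfl := Subsingleton.elim 0 t
  rw [hprior w]
  exact h

lemma singleLoss_le_capacity (hε : ε ∈ Set.Ioo (0 : ℝ) 1) (hA : MeasurableSet A)
    (hp : IsDensityOn 𝒳 p) (hH : HasFiniteEntropy p) : singleLoss ε p A ≤ capacity ε := by
  simpa [singleLoss] using
    cycleLoss_le (fun _ => hε) (isMeasurable_ofJoint fun _ : Fin 1 => hA) hp hH

lemma singleLoss_eq_capacity_of_mass_eq_half (hε : ε ∈ Set.Ioo (0 : ℝ) 1) (hA : MeasurableSet A)
    (hp : IsDensityOn 𝒳 p) (hH : HasFiniteEntropy p) (hmass : mass p A = 1 / 2) :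
    singleLoss ε p A = capacity ε := by
  simpa [singleLoss] using cycleLoss_eq_of_isBisection (fun _ => hε)
    (isMeasurable_ofJoint fun _ : Fin 1 => hA) hp hH ((isBisection_single_iff hp).2 hmass)

lemma mass_eq_half_of_singleLoss_eq_capacity (hε : ε ∈ Set.Ioo (0 : ℝ) 1) (hε' : ε ≠ 1 / 2)
    (hA : MeasurableSet A) (hp : IsDensityOn 𝒳 p) (hH : HasFiniteEntropy p)
    (h : singleLoss ε p A = capacity ε) : mass p A = 1 / 2 :=
  (isBisection_single_iff hp).1 <| isBisection_of_cycleLoss_eq (M := 1) (fun _ => hε)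
    (fun _ => hε') (isMeasurable_ofJoint fun _ => hA) hp hH (by simpa [singleLoss] using h)

end SingleQuery

lemma measurableSet_rect (a b : Fin d → ℝ) : MeasurableSet (rect a b) :=
  MeasurableSet.univ_pi fun _ => measurableSet_Ico

lemma IsQueryRegion.measurableSet {J : ℕ} {Q : Set (Fin d → ℝ)} (h : IsQueryRegion 𝒳 J Q) :
    MeasurableSet Q := by
  obtain ⟨a, b, -, rfl⟩ := h
  exact MeasurableSet.iUnion fun j => measurableSet_rect _ _

variable {J : Fin M → ℕ}

lemma SeqDesign.Admissible.isMeasurable (hD : D.Admissible 𝒳 J) : D.IsMeasurable :=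
  fun t w => (hD t w).measurableSet

lemma isGreedy_of_isBisection (hε : ∀ m, ε m ∈ Set.Ioo (0 : ℝ) 1) (hp : IsDensityOn 𝒳 p)
    (hH : HasFiniteEntropy p) (hD : D.Admissible 𝒳 J) (hB : IsBisection ε p D) :
    IsGreedy 𝒳 J ε p D := by
  refine ⟨hD, fun t w A hA => ?_⟩
  have hq := isDensityOn_subPosterior hε hD.isMeasurable hp t w
  have hqH := hasFiniteEntropy_subPosterior hε hD.isMeasurable hp hH t w
  rw [singleLoss_eq_capacity_of_mass_eq_half (hε t) (hD.isMeasurable t w) hq hqH (hB t w)]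
  exact singleLoss_le_capacity (hε t) hA.measurableSet hq hqH

lemma IsGreedy.isBisection (hε : ∀ m, ε m ∈ Set.Ioo (0 : ℝ) 1) (hε' : ∀ m, ε m ≠ 1 / 2)
    (hp : IsDensityOn 𝒳 p) (hH : HasFiniteEntropy p) (hD : IsGreedy 𝒳 J ε p D)
    (hbisect : ∀ t w, ∃ A, IsQueryRegion 𝒳 (J t) A ∧ mass (subPosterior ε p D t w) A = 1 / 2) :
    IsBisection ε p D := by
  intro t w
  have hmeas := hD.1.isMeasurable
  have hq := isDensityOn_subPosterior hε hmeas hp t w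
  have hqH := hasFiniteEntropy_subPosterior hε hmeas hp hH t w
  obtain ⟨A, hA, hmass⟩ := hbisect t w
  refine mass_eq_half_of_singleLoss_eq_capacity (hε t) (hε' t) (hmeas t w) hq hqH <|
    (singleLoss_le_capacity (hε t) (hmeas t w) hq hqH).antisymm ?_
  rw [← singleLoss_eq_capacity_of_mass_eq_half (hε t) hA.measurableSet hq hqH hmass]
  exact hD.2 t w A hA

/-! ### Joint batches -/

lemma mem_cell {i : Fin M → Bool} {x : Fin d → ℝ} :
    x ∈ cell A i ↔ ∀ m, i m = true ↔ x ∈ A m := by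
  rw [cell, Set.mem_iInter]
  exact forall_congr' fun m => by cases i m <;> simp

lemma measurableSet_cell (hA : ∀ m, MeasurableSet (A m)) (i : Fin M → Bool) :
    MeasurableSet (cell A i) :=
  .iInter fun m => by split_ifs; exacts [hA m, (hA m).compl]

lemma cycleLik_ofJoint (ε : Fin M → ℝ) (A : Fin M → Set (Fin d → ℝ)) (y : Fin M → Bool)
    (x : Fin d → ℝ) : cycleLik ε (ofJoint A) y x = ∏ m, bsc (ε m) (A m) x (y m) :=
  rfl

lemma cycleLik_zero_ofJoint (A : Fin M → Set (Fin d → ℝ)) (i : Fin M → Bool) :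
    cycleLik 0 (ofJoint A) i = (cell A i).indicator fun _ => 1 := by
  classical
  funext x
  have hbsc (m : Fin M) : bsc 0 (A m) x (i m) = if (i m = true ↔ x ∈ A m) then 1 else 0 := by
    simp [bsc]
  simp only [cycleLik_ofJoint, Pi.zero_apply, hbsc, Finset.prod_ite_zero, Finset.prod_const_one,
    Finset.mem_univ, true_imp_iff, Set.indicator_apply, mem_cell]

lemma evidence_cycleLik_zero_ofJoint (hA : ∀ m, MeasurableSet (A m)) (i : Fin M → Bool) :
    evidence p (cycleLik 0 (ofJoint A) i) = mass p (cell A i) := by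
  rw [evidence, cycleLik_zero_ofJoint, mass, ← integral_indicator (measurableSet_cell hA i)]
  congr 1 with x
  by_cases hx : x ∈ cell A i <;> simp [hx]

lemma integrable_cycleLik_mul (hε : ∀ m, ε m ∈ Set.Icc (0 : ℝ) 1) (hD : D.IsMeasurable)
    (hp : Integrable p) (y : Fin M → Bool) : Integrable fun x => cycleLik ε D y x * p x :=
  hp.bdd_mul (c := 1) (measurable_prefixLik hD M le_rfl y).aestronglyMeasurable <|
    .of_forall fun x => by
      obtain ⟨h0, h1⟩ : cycleLik ε D y x ∈ Set.Icc 0 1 := prefixLik_mem_Icc hε M le_rfl y x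
      rwa [Real.norm_of_nonneg h0]

lemma sum_mass_cell (hA : ∀ m, MeasurableSet (A m)) (hp : IsDensityOn 𝒳 p) :
    ∑ i, mass p (cell A i) = 1 := by
  simp only [← evidence_cycleLik_zero_ofJoint hA, evidence]
  rw [← integral_finsetSum _ fun i _ =>
    integrable_cycleLik_mul (by simp) (isMeasurable_ofJoint hA) hp.integrable i]
  simp only [← Finset.sum_mul, sum_cycleLik, one_mul, hp.integral_eq_one]

/-- A binary symmetric channel followed by one with crossover `α` is again one. The crossover `α`
may lie outside `[0, 1]`, so that channels can also be made less noisy. -/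
lemma bsc_eq_sum_bsc {α ε ε' : ℝ} (hα : α * (1 - 2 * ε) = ε' - ε) (A : Set (Fin d → ℝ))
    (x : Fin d → ℝ) (y : Bool) :
    bsc ε' A x y = ∑ b, (if y = b then 1 - α else α) * bsc ε A x b := by
  by_cases hx : x ∈ A <;> cases y <;> simp [bsc, hx]
  · linear_combination -hα
  · linear_combination hα
  · linear_combination hα
  · linear_combination -hα

/-- The rows of the matrices that change the noise sum to `1`, so they preserve the uniform law. -/
lemma evidence_cycleLik_ofJoint_of_forall_eq (hε : ∀ m, ε m ∈ Set.Icc (0 : ℝ) 1)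
    (hε2 : ∀ m, ε m ≠ 1 / 2) (hA : ∀ m, MeasurableSet (A m)) (hp : Integrable p) {v : ℝ}
    (h : ∀ b, evidence p (cycleLik ε (ofJoint A) b) = v) (y : Fin M → Bool) :
    evidence p (cycleLik ε' (ofJoint A) y) = v := by
  let α (m : Fin M) : ℝ := (ε' m - ε m) / (1 - 2 * ε m)
  have hα (m : Fin M) : α m * (1 - 2 * ε m) = ε' m - ε m :=
    div_mul_cancel₀ _ fun h => hε2 m (by linarith)
  let k (m : Fin M) (b : Bool) : ℝ := if y m = b then 1 - α m else α m
  have hk (m : Fin M) : ∑ b, k m b = 1 := by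
    rw [Fintype.sum_bool]
    cases hy : y m <;> simp [k, hy]
  have hlik (x : Fin d → ℝ) : cycleLik ε' (ofJoint A) y x =
      ∑ b, (∏ m, k m (b m)) * cycleLik ε (ofJoint A) b x :=
    calc cycleLik ε' (ofJoint A) y x = ∏ m, ∑ b, k m b * bsc (ε m) (A m) x b := by
          rw [cycleLik_ofJoint]
          exact Finset.prod_congr rfl fun m _ => bsc_eq_sum_bsc (hα m) (A m) x (y m)
      _ = ∑ b : Fin M → Bool, ∏ m, k m (b m) * bsc (ε m) (A m) x (b m) := by
          rw [Finset.prod_univ_sum, Fintype.piFinset_univ]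
      _ = ∑ b, (∏ m, k m (b m)) * cycleLik ε (ofJoint A) b x :=
          Finset.sum_congr rfl fun b _ => Finset.prod_mul_distrib
  calc evidence p (cycleLik ε' (ofJoint A) y)
      = ∑ b, (∏ m, k m (b m)) * evidence p (cycleLik ε (ofJoint A) b) := by
        simp only [evidence, hlik, Finset.sum_mul, mul_assoc]
        rw [integral_finsetSum _ fun b _ =>
          (integrable_cycleLik_mul hε (isMeasurable_ofJoint hA) hp b).const_mul _]
        simp only [integral_const_mul]
    _ = (∏ m, ∑ b, k m b) * v := by
        simp only [h, ← Finset.sum_mul, Finset.prod_univ_sum, Fintype.piFinset_univ]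
    _ = v := by simp only [hk, Finset.prod_const_one, one_mul]

lemma cycleLoss_ofJoint_eq_iff (hε : ∀ m, ε m ∈ Set.Ioo (0 : ℝ) 1) (hε2 : ∀ m, ε m ≠ 1 / 2)
    (hA : ∀ m, MeasurableSet (A m)) (hp : IsDensityOn 𝒳 p) (hH : HasFiniteEntropy p) :
    cycleLoss ε p (ofJoint A) = ∑ m, capacity (ε m) ↔
      ∀ i, mass p (cell A i) = (2 : ℝ)⁻¹ ^ M := by
  rw [cycleLoss_eq_iff_evidence hε (isMeasurable_ofJoint hA) hp hH]
  simp only [← evidence_cycleLik_zero_ofJoint hA]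
  exact ⟨fun h => evidence_cycleLik_ofJoint_of_forall_eq
      (fun m => Set.Ioo_subset_Icc_self (hε m)) hε2 hA hp.integrable h,
    fun h => evidence_cycleLik_ofJoint_of_forall_eq (by simp) (by simp) hA hp.integrable h⟩

end Cycle

section Cutting

variable {d M : ℕ} {𝒳 Q : Set (Fin d → ℝ)} {p : (Fin d → ℝ) → ℝ} {K : ℕ}

/-! ### Cutting regions by hyperplanes -/

lemma mem_rect {a b x : Fin d → ℝ} : x ∈ rect a b ↔ ∀ l, a l ≤ x l ∧ x l < b l := by
  simp [rect]

lemma rect_self (hd : 0 < d) (a : Fin d → ℝ) : rect a a = ∅ :=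
  Set.eq_empty_of_forall_notMem fun _ hx =>
    lt_irrefl _ ((mem_rect.1 hx ⟨0, hd⟩).1.trans_lt (mem_rect.1 hx ⟨0, hd⟩).2)

namespace IsQueryRegion

lemma iUnion {ι : Type*} [Fintype ι] {S : ι → Set (Fin d → ℝ)}
    (hS : ∀ i, IsQueryRegion 𝒳 K (S i)) :
    IsQueryRegion 𝒳 (Fintype.card ι * K) (⋃ i, S i) := by
  choose a b hab hS using hS
  let e : Fin (Fintype.card ι * K) ≃ ι × Fin K :=
    finProdFinEquiv.symm.trans ((Fintype.equivFin ι).symm.prodCongr (Equiv.refl _))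
  refine ⟨fun j => a (e j).1 (e j).2, fun j => b (e j).1 (e j).2, fun j => hab _ _, ?_⟩
  rw [e.surjective.iUnion_comp fun ik => rect (a ik.1 ik.2) (b ik.1 ik.2), Set.iUnion_prod']
  exact Set.iUnion_congr hS

lemma mono (hd : 0 < d) {J : ℕ} (hKJ : K ≤ J) (hQ : IsQueryRegion 𝒳 K Q) :
    IsQueryRegion 𝒳 J Q := by
  obtain ⟨a, b, hab, rfl⟩ := hQ
  obtain ⟨r, rfl⟩ := Nat.exists_eq_add_of_le hKJ
  refine ⟨Fin.append a 0, Fin.append b 0, fun j => ?_, ?_⟩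
  · induction j using Fin.addCases with
    | left k => simpa using hab k
    | right k => simp [rect_self hd]
  · rw [← finSumFinEquiv.surjective.iUnion_comp, Set.iUnion_sum]
    simp [rect_self hd]

lemma empty (hd : 0 < d) (𝒳 : Set (Fin d → ℝ)) (J : ℕ) : IsQueryRegion 𝒳 J ∅ :=
  mono hd J.zero_le ⟨0, 0, fun k => k.elim0, (Set.iUnion_of_empty _).symm⟩

lemma inter_lt (hQ : IsQueryRegion 𝒳 K Q) (l : Fin d) (s : ℝ) :
    IsQueryRegion 𝒳 K (Q ∩ {x | x l < s}) := by
  obtain ⟨a, b, hab, rfl⟩ := hQ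
  let b' (k : Fin K) : Fin d → ℝ := Function.update (b k) l (max (a k l) (min (b k l) s))
  have hrect (k : Fin K) : rect (a k) (b' k) = rect (a k) (b k) ∩ {x | x l < s} := by
    ext x
    simp only [Set.mem_inter_iff, mem_rect, Set.mem_ofPred_eq, b',
      Function.forall_update_iff (b k) fun j t => a k j ≤ x j ∧ x j < t]
    grind
  refine ⟨a, b', fun k => ⟨?_, ?_⟩, ?_⟩
  · exact le_update_iff.2 ⟨le_max_left _ _, fun j _ => (hab k).1 j⟩
  · exact hrect k ▸ Set.inter_subset_left.trans (hab k).2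
  · simp only [hrect, Set.iUnion_inter]

lemma inter_ge (hQ : IsQueryRegion 𝒳 K Q) (l : Fin d) (s : ℝ) :
    IsQueryRegion 𝒳 K (Q ∩ {x | s ≤ x l}) := by
  obtain ⟨a, b, hab, rfl⟩ := hQ
  let a' (k : Fin K) : Fin d → ℝ := Function.update (a k) l (min (b k l) (max (a k l) s))
  have hrect (k : Fin K) : rect (a' k) (b k) = rect (a k) (b k) ∩ {x | s ≤ x l} := by
    ext x
    simp only [Set.mem_inter_iff, mem_rect, Set.mem_ofPred_eq, a',
      Function.forall_update_iff (a k) fun j t => t ≤ x j ∧ x j < b k j]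
    grind
  refine ⟨a', b, fun k => ⟨?_, ?_⟩, ?_⟩
  · exact update_le_iff.2 ⟨min_le_left _ _, fun j _ => (hab k).1 j⟩
  · exact hrect k ▸ Set.inter_subset_left.trans (hab k).2
  · simp only [hrect, Set.iUnion_inter]

end IsQueryRegion

lemma measurableSet_coord_lt (l : Fin d) (s : ℝ) : MeasurableSet {x : Fin d → ℝ | x l < s} :=
  measurableSet_lt (measurable_pi_apply l) measurable_const

lemma IsDensityOn.mass_mono (hp : IsDensityOn 𝒳 p) {R S : Set (Fin d → ℝ)} (h : R ⊆ S) :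
    mass p R ≤ mass p S :=
  setIntegral_mono_set hp.integrable.integrableOn (.of_forall hp.nonneg) h.eventuallyLE

lemma continuous_mass_inter_coord_lt (hp : Integrable p) (Q : Set (Fin d → ℝ)) (l : Fin d) :
    Continuous fun s => mass p (Q ∩ {x | x l < s}) := by
  have hmass (s : ℝ) :
      mass p (Q ∩ {x | x l < s}) = ∫ x in Q, {x : Fin d → ℝ | x l < s}.indicator p x := by
    rw [mass, setIntegral_indicator (measurableSet_coord_lt l s)]
  simp only [hmass]
  refine continuous_iff_continuousAt.2 fun s => continuousAt_of_dominated (bound := fun x => ‖p x‖)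
    (.of_forall fun r => hp.restrict.aestronglyMeasurable.indicator (measurableSet_coord_lt l r))
    (.of_forall fun r => .of_forall fun x => norm_indicator_le_norm_self _ _) hp.restrict.norm
    (ae_restrict_of_ae ?_)
  have hnull : volume {x : Fin d → ℝ | x l = s} = 0 :=
    Measure.pi_hyperplane (α := fun _ => ℝ) (fun _ => volume) l s
  filter_upwards [measure_eq_zero_iff_ae_notMem.1 hnull] with x hx
  rcases lt_or_gt_of_ne (show x l ≠ s from hx) with hlt | hgt
  · refine continuousAt_const (y := p x) |>.congr ?_
    filter_upwards [lt_mem_nhds hlt] with r hr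
    exact (Set.indicator_of_mem (s := {x : Fin d → ℝ | x l < r}) hr p).symm
  · refine continuousAt_const (y := (0 : ℝ)) |>.congr ?_
    filter_upwards [gt_mem_nhds hgt] with r hr
    exact (Set.indicator_of_notMem (s := {x : Fin d → ℝ | x l < r}) (not_lt.2 hr.le) p).symm

lemma exists_mass_inter_coord_lt_eq (hp : Integrable p) (hQ : IsQueryRegion 𝒳 K Q) (l : Fin d)
    {v : ℝ} (hv₀ : 0 ≤ v) (hv : v ≤ mass p Q) : ∃ s, mass p (Q ∩ {x | x l < s}) = v := by
  obtain ⟨a, b, -, rfl⟩ := hQ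
  obtain ⟨lo, hlo⟩ := (Set.finite_range fun k => a k l).bddBelow
  obtain ⟨hi, hhi⟩ := (Set.finite_range fun k => b k l).bddAbove
  have hbelow : (⋃ k, rect (a k) (b k)) ∩ {x | x l < lo} = ∅ := by
    refine Set.eq_empty_of_forall_notMem fun x ⟨hx, hxlo⟩ => ?_
    obtain ⟨k, hk⟩ := Set.mem_iUnion.1 hx
    exact (lt_of_lt_of_le hxlo (hlo ⟨k, rfl⟩)).not_ge (mem_rect.1 hk l).1
  have habove : (⋃ k, rect (a k) (b k)) ⊆ {x | x l < hi} :=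
    Set.iUnion_subset fun k x hx => (mem_rect.1 hx l).2.trans_le (hhi ⟨k, rfl⟩)
  refine mem_range_of_exists_le_of_exists_ge (continuous_mass_inter_coord_lt hp _ l)
    ⟨lo, ?_⟩ ⟨hi, ?_⟩
  · rwa [hbelow, mass, setIntegral_empty]
  · rwa [Set.inter_eq_left.2 habove]

lemma mass_inter_coord_lt_add_ge (hp : Integrable p) (Q : Set (Fin d → ℝ)) (l : Fin d) (s : ℝ) :
    mass p (Q ∩ {x | x l < s}) + mass p (Q ∩ {x | s ≤ x l}) = mass p Q := by
  have hcompl : Q ∩ {x | s ≤ x l} = Q \ {x | x l < s} := by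
    ext x
    simp
  rw [hcompl]
  exact integral_inter_add_sdiff (measurableSet_coord_lt l s) hp.integrableOn

lemma exists_query_mass_eq (hd : 0 < d) (hp : Integrable p) (hQ : IsQueryRegion 𝒳 K Q) {v : ℝ}
    (hv₀ : 0 ≤ v) (hv : v ≤ mass p Q) : ∃ A, IsQueryRegion 𝒳 K A ∧ mass p A = v := by
  obtain ⟨s, hs⟩ := exists_mass_inter_coord_lt_eq hp hQ ⟨0, hd⟩ hv₀ hv
  exact ⟨_, hQ.inter_lt _ s, hs⟩

/-- The slabs that parallel hyperplanes cut off `Q` one after the other. -/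
lemma exists_disjoint_queries_mass_eq {ι : Type*} (hd : 0 < d) (hp : Integrable p) {η : ι → ℝ}
    (hη : ∀ i, 0 ≤ η i) (T : Finset ι) :
    ∀ {Q : Set (Fin d → ℝ)}, IsQueryRegion 𝒳 K Q → ∑ i ∈ T, η i ≤ mass p Q →
      ∃ S : ι → Set (Fin d → ℝ), (∀ i, IsQueryRegion 𝒳 K (S i)) ∧ (∀ i, S i ⊆ Q) ∧
        Pairwise (Function.onFun Disjoint S) ∧ ∀ i ∈ T, mass p (S i) = η i := by
  classical
  induction T using Finset.induction_on with
  | empty =>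
    exact fun _ _ => ⟨fun _ => ∅, fun _ => .empty hd 𝒳 K, fun _ => Set.empty_subset _,
      fun _ _ _ => Set.disjoint_empty _, by simp⟩
  | insert j T hj ih =>
    intro Q hQ hsum
    rw [Finset.sum_insert hj] at hsum
    obtain ⟨s, hs⟩ := exists_mass_inter_coord_lt_eq hp hQ ⟨0, hd⟩ (hη j)
      ((le_add_of_nonneg_right (Finset.sum_nonneg fun i _ => hη i)).trans hsum)
    have hadd := mass_inter_coord_lt_add_ge hp Q ⟨0, hd⟩ s
    obtain ⟨S, hS, hSQ, hdisj, hmass⟩ := ih (hQ.inter_ge ⟨0, hd⟩ s) (by linarith)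
    set slab := Q ∩ {x | x ⟨0, hd⟩ < s} with hslab
    have hslabS (i : ι) : Disjoint slab (S i) :=
      Set.disjoint_left.2 fun x ⟨_, (hlt : x _ < s)⟩ hxS => hlt.not_ge (hSQ i hxS).2
    refine ⟨Function.update S j slab, fun i => ?_, fun i => ?_, fun i k hik => ?_, fun i hi => ?_⟩
    · obtain rfl | hij := eq_or_ne i j
      · simpa using hQ.inter_lt ⟨0, hd⟩ s
      · simpa [hij] using hS i
    · obtain rfl | hij := eq_or_ne i j
      · simp [hslab]
      · simpa [hij] using (hSQ i).trans Set.inter_subset_left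
    · obtain rfl | hij := eq_or_ne i j
      · simpa [Function.onFun, hik.symm] using hslabS k
      · obtain rfl | hkj := eq_or_ne k j
        · simpa [Function.onFun, hij] using (hslabS i).symm
        · simpa [Function.onFun, hij, hkj] using hdisj hik
    · obtain rfl | hij := eq_or_ne i j
      · simpa using hs
      · simpa [hij] using hmass i (Finset.mem_of_mem_insert_of_ne hi hij)

lemma cell_iUnion {S : (Fin M → Bool) → Set (Fin d → ℝ)}
    (hS : Pairwise (Function.onFun Disjoint S)) {i : Fin M → Bool} (hi : i ≠ fun _ => false) :
    cell (fun m => ⋃ c, if c m then S c else ∅) i = S i := by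
  have huniq {c c' : Fin M → Bool} {x : Fin d → ℝ} (hx : x ∈ S c) (hx' : x ∈ S c') : c = c' :=
    hS.eq (Set.not_disjoint_iff.2 ⟨x, hx, hx'⟩)
  obtain ⟨m₀, hm₀⟩ : ∃ m, i m = true := by simpa [funext_iff] using hi
  ext x
  simp only [mem_cell, Set.mem_iUnion, Set.mem_ite_empty_right]
  constructor
  · intro h
    obtain ⟨c, -, hc⟩ := (h m₀).1 hm₀
    have hic : i = c := funext fun m => by
      rw [Bool.eq_iff_iff, h m]
      exact ⟨fun ⟨c', hc'm, hc'⟩ => huniq hc hc' ▸ hc'm, fun hcm => ⟨c, hcm, hc⟩⟩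
    exact hic ▸ hc
  · exact fun hx m => ⟨fun him => ⟨i, him, hx⟩, fun ⟨c, hcm, hc⟩ => huniq hc hx ▸ hcm⟩

lemma exists_equalizing_batch (hd : 0 < d) (hp : IsDensityOn 𝒳 p) (hQ : IsQueryRegion 𝒳 K Q)
    (hmass : 1 - (2 : ℝ)⁻¹ ^ M ≤ mass p Q) :
    ∃ A : Fin M → Set (Fin d → ℝ), (∀ m, IsQueryRegion 𝒳 (2 ^ M * K) (A m)) ∧
      ∀ i, mass p (cell A i) = (2 : ℝ)⁻¹ ^ M := by
  let T : Finset (Fin M → Bool) := Finset.univ.erase fun _ => false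
  have hsum : ∑ _ : Fin M → Bool, (2 : ℝ)⁻¹ ^ M = 1 := by simp
  have hT : ∑ _ ∈ T, (2 : ℝ)⁻¹ ^ M = 1 - (2 : ℝ)⁻¹ ^ M := by
    rw [Finset.sum_erase_eq_sub (Finset.mem_univ _), hsum]
  obtain ⟨S, hS, -, hdisj, hmassS⟩ := exists_disjoint_queries_mass_eq hd hp.integrable
    (η := fun _ => (2 : ℝ)⁻¹ ^ M) (fun _ => by positivity) T hQ (hT.trans_le hmass)
  let A (m : Fin M) : Set (Fin d → ℝ) := ⋃ c, if c m then S c else ∅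
  have hA (m : Fin M) : IsQueryRegion 𝒳 (2 ^ M * K) (A m) := by
    have hcard : Fintype.card (Fin M → Bool) = 2 ^ M := by simp
    rw [← hcard]
    refine .iUnion fun c => ?_
    split_ifs
    exacts [hS c, .empty hd 𝒳 K]
  have hcell (i : Fin M → Bool) (hi : i ≠ fun _ => false) :
      mass p (cell A i) = (2 : ℝ)⁻¹ ^ M := by
    rw [cell_iUnion hdisj hi, hmassS i (Finset.mem_erase.2 ⟨hi, Finset.mem_univ i⟩)]
  refine ⟨A, hA, fun i => ?_⟩
  obtain rfl | hi := eq_or_ne i fun _ => false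
  · have htotal := sum_mass_cell (fun m => (hA m).measurableSet) hp
    rw [← Finset.add_sum_erase _ _ (Finset.mem_univ fun _ => false),
      Finset.sum_congr rfl fun i hi => hcell i (Finset.ne_of_mem_erase hi), hT] at htotal
    linarith
  · exact hcell i hi

end Cutting

section Exhaustion

variable {d M : ℕ} {𝒳 Q : Set (Fin d → ℝ)} {p q p₀ L : (Fin d → ℝ) → ℝ} {c κ η : ℝ}

/-! ### Exhausting densities by rectangles -/

lemma isQueryRegion_rect {a b : Fin d → ℝ} (hab : a ≤ b) (h : rect a b ⊆ 𝒳) :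
    IsQueryRegion 𝒳 1 (rect a b) :=
  ⟨fun _ => a, fun _ => b, fun _ => ⟨hab, h⟩, (Set.iUnion_const _).symm⟩

lemma exists_rect_mem_nhds {U : Set (Fin d → ℝ)} {x : Fin d → ℝ} (hU : U ∈ nhds x) :
    ∃ a b, a ≤ b ∧ rect a b ⊆ U ∧ rect a b ∈ nhds x := by
  obtain ⟨r, hr, hrU⟩ := Metric.mem_nhds_iff.1 hU
  refine ⟨fun l => x l - r / 2, fun l => x l + r / 2, fun l => by linarith,
    fun y hy => hrU ?_, set_pi_mem_nhds Set.finite_univ fun l _ =>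
      Ico_mem_nhds (by linarith) (by linarith)⟩
  rw [Metric.mem_ball, dist_pi_lt_iff hr]
  intro l
  have hyl := mem_rect.1 hy l
  rw [Real.dist_eq, abs_lt]
  constructor <;> linarith [hyl.1, hyl.2]

lemma exists_isQueryRegion_superset {C : Set (Fin d → ℝ)} (hC : IsCompact C)
    (hC𝒳 : C ⊆ interior 𝒳) : ∃ K Q, IsQueryRegion 𝒳 K Q ∧ C ⊆ Q := by
  choose! a b hab h𝒳 hnhds using fun x (hx : x ∈ interior 𝒳) =>
    exists_rect_mem_nhds (mem_interior_iff_mem_nhds.1 hx)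
  obtain ⟨T, hT, hcover⟩ :=
    hC.elim_nhds_subcover (fun x => rect (a x) (b x)) fun x hx => hnhds x (hC𝒳 hx)
  refine ⟨_, ⋃ x : T, rect (a x) (b x), .iUnion (K := 1) fun x => ?_, ?_⟩
  · exact isQueryRegion_rect (hab x (hC𝒳 (hT x x.2))) (h𝒳 x (hC𝒳 (hT x x.2)))
  · exact hcover.trans_eq (Set.iUnion_subtype (· ∈ T) fun x => rect (a x) (b x)).symm

lemma IsDensityOn.mass_interior (h𝒳 : volume (𝒳 \ interior 𝒳) = 0) (hp : IsDensityOn 𝒳 p) :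
    mass p (interior 𝒳) = 1 := by
  rw [← hp.integral_eq_one, mass]
  refine setIntegral_eq_integral_of_ae_compl_eq_zero ?_
  filter_upwards [measure_eq_zero_iff_ae_notMem.1 h𝒳] with x hx hxi
  exact hp.support x fun h => hx ⟨h, hxi⟩

lemma IsDensityOn.exists_isCompact_mass_gt (hp : IsDensityOn 𝒳 p) {U : Set (Fin d → ℝ)}
    (hU : IsOpen U) {v : ℝ} (hv : v < mass p U) : ∃ C ⊆ U, IsCompact C ∧ v < mass p C := by
  let ν : Measure (Fin d → ℝ) := volume.withDensity fun x => ENNReal.ofReal (p x)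
  have hν {S : Set (Fin d → ℝ)} (hS : MeasurableSet S) : ν S = ENNReal.ofReal (mass p S) := by
    rw [withDensity_apply _ hS, mass, ofReal_integral_eq_lintegral_ofReal
      hp.integrable.integrableOn (.of_forall hp.nonneg)]
  have : IsFiniteMeasure ν := ⟨by rw [hν .univ]; exact ENNReal.ofReal_lt_top⟩
  obtain hv₀ | hv₀ := lt_or_ge v 0
  · exact ⟨∅, Set.empty_subset U, isCompact_empty, by simpa [mass] using hv₀⟩
  obtain ⟨C, hCU, hC, hlt⟩ := hU.exists_lt_isCompact (μ := ν) (r := ENNReal.ofReal v) <| by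
    rwa [hν hU.measurableSet, ENNReal.ofReal_lt_ofReal_iff (hv₀.trans_lt hv)]
  rw [hν hC.measurableSet] at hlt
  exact ⟨C, hCU, hC, (ENNReal.ofReal_lt_ofReal_iff'.1 hlt).1⟩

lemma IsDensityOn.exists_isQueryRegion_mass_ge (h𝒳 : volume (𝒳 \ interior 𝒳) = 0)
    (hp : IsDensityOn 𝒳 p) (hη : 0 < η) :
    ∃ K Q, IsQueryRegion 𝒳 K Q ∧ 1 - η ≤ mass p Q := by
  obtain ⟨C, hC𝒳, hC, hmass⟩ := hp.exists_isCompact_mass_gt isOpen_interior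
    (show 1 - η < mass p (interior 𝒳) by rw [hp.mass_interior h𝒳]; linarith)
  obtain ⟨K, Q, hQ, hCQ⟩ := exists_isQueryRegion_superset hC hC𝒳
  exact ⟨K, Q, hQ, hmass.le.trans (hp.mass_mono hCQ)⟩

lemma IsDensityOn.mass_compl (hp : IsDensityOn 𝒳 p) (hQ : MeasurableSet Q) :
    mass p Qᶜ = 1 - mass p Q := by
  rw [mass, setIntegral_compl hQ hp.integrable, hp.integral_eq_one, mass]

/-- The probability densities on `𝒳` that are at most `κ p₀`. The posteriors of the first cycles
belong to one such class, over which the prior controls the mass outside a region uniformly. -/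
structure IsDominatedDensity (𝒳 : Set (Fin d → ℝ)) (p₀ : (Fin d → ℝ) → ℝ) (κ : ℝ)
    (q : (Fin d → ℝ) → ℝ) : Prop extends IsDensityOn 𝒳 q where
  le_mul : ∀ x, q x ≤ κ * p₀ x

namespace IsDominatedDensity

lemma mono (hp₀ : IsDensityOn 𝒳 p₀) {κ' : ℝ} (hκ : κ ≤ κ') (hq : IsDominatedDensity 𝒳 p₀ κ q) :
    IsDominatedDensity 𝒳 p₀ κ' q :=
  ⟨hq.toIsDensityOn, fun x => (hq.le_mul x).trans (mul_le_mul_of_nonneg_right hκ (hp₀.nonneg x))⟩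

lemma bayes (hL : IsLikelihood c L) (hq : IsDominatedDensity 𝒳 p₀ κ q) :
    IsDominatedDensity 𝒳 p₀ (c⁻¹ * κ) (bayes q L) :=
  ⟨hL.isDensityOn_bayes hq.toIsDensityOn, fun x =>
    (hL.bayes_le hq.toIsDensityOn x).trans <| by
      rw [mul_assoc]
      exact mul_le_mul_of_nonneg_left (hq.le_mul x) (inv_nonneg.2 hL.pos.le)⟩

lemma mass_le (hp₀ : IsDensityOn 𝒳 p₀) (hq : IsDominatedDensity 𝒳 p₀ κ q)
    (R : Set (Fin d → ℝ)) : mass q R ≤ κ * mass p₀ R := by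
  rw [mass, mass, ← integral_const_mul]
  exact integral_mono hq.integrable.integrableOn (hp₀.integrable.integrableOn.const_mul κ) hq.le_mul

end IsDominatedDensity

lemma exists_isQueryRegion_forall_mass_ge (h𝒳 : volume (𝒳 \ interior 𝒳) = 0)
    (hp₀ : IsDensityOn 𝒳 p₀) (hκ : 0 < κ) (hη : 0 < η) :
    ∃ K Q, IsQueryRegion 𝒳 K Q ∧ ∀ q, IsDominatedDensity 𝒳 p₀ κ q → 1 - η ≤ mass q Q := by
  obtain ⟨K, Q, hQ, hmass⟩ := hp₀.exists_isQueryRegion_mass_ge h𝒳 (div_pos hη hκ)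
  refine ⟨K, Q, hQ, fun q hq => ?_⟩
  have hcompl : mass q Qᶜ ≤ η :=
    calc mass q Qᶜ ≤ κ * mass p₀ Qᶜ := hq.mass_le hp₀ Qᶜ
      _ ≤ κ * (η / κ) := by
        rw [hp₀.mass_compl hQ.measurableSet]
        gcongr
        linarith
      _ = η := mul_div_cancel₀ η hκ.ne'
  rw [hq.mass_compl hQ.measurableSet] at hcompl
  linarith

end Exhaustion

section Policy

variable {d M : ℕ} {𝒳 : Set (Fin d → ℝ)} {p₀ : (Fin d → ℝ) → ℝ} {ε : Fin M → ℝ}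

/-! ### Policies -/

section Posterior

variable {σ : SeqPolicy d M}

lemma isDominatedDensity_posterior (hε : ∀ m, ε m ∈ Set.Ioo (0 : ℝ) 1)
    (hσ : ∀ n h, (σ n h).IsMeasurable) (hp₀ : IsDensityOn 𝒳 p₀) (n : ℕ) (h : History M n) :
    IsDominatedDensity 𝒳 p₀ ((minLik ε)⁻¹ ^ n) (posterior ε p₀ σ n h) := by
  induction n with
  | zero => exact ⟨hp₀, by simp [posterior]⟩
  | succ n ih =>
    rw [pow_succ']
    exact (ih _).bayes (isLikelihood_cycleLik hε (hσ n _) _)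

lemma hasFiniteEntropy_posterior (hε : ∀ m, ε m ∈ Set.Ioo (0 : ℝ) 1)
    (hσ : ∀ n h, (σ n h).IsMeasurable) (hp₀ : IsDensityOn 𝒳 p₀) (hH : HasFiniteEntropy p₀)
    (n : ℕ) (h : History M n) : HasFiniteEntropy (posterior ε p₀ σ n h) := by
  induction n with
  | zero => exact hH
  | succ n ih =>
    exact (isLikelihood_cycleLik hε (hσ n _) _).hasFiniteEntropy_bayes
      (isDominatedDensity_posterior hε hσ hp₀ n _).toIsDensityOn (ih _)

lemma historyProb_pos (hε : ∀ m, ε m ∈ Set.Ioo (0 : ℝ) 1) (hσ : ∀ n h, (σ n h).IsMeasurable)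
    (hp₀ : IsDensityOn 𝒳 p₀) (n : ℕ) (h : History M n) : 0 < historyProb ε p₀ σ n h := by
  induction n with
  | zero => exact one_pos
  | succ n ih =>
    exact mul_pos (ih _) <| (isLikelihood_cycleLik hε (hσ n _) _).evidence_pos
      (isDominatedDensity_posterior hε hσ hp₀ n _).toIsDensityOn

lemma sum_historyProb (hε : ∀ m, ε m ∈ Set.Ioo (0 : ℝ) 1) (hσ : ∀ n h, (σ n h).IsMeasurable)
    (hp₀ : IsDensityOn 𝒳 p₀) (n : ℕ) : ∑ h, historyProb ε p₀ σ n h = 1 := by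
  induction n with
  | zero => simp [historyProb]
  | succ n ih =>
    simp only [sum_eq_sum_snoc, historyProb, Fin.init_snoc, Fin.snoc_last, ← Finset.mul_sum,
      sum_evidence_cycleLik hε (hσ n _) (isDominatedDensity_posterior hε hσ hp₀ n _).toIsDensityOn,
      mul_one, ih]

lemma expectedEntropy_eq (ε : Fin M → ℝ) (p₀ : (Fin d → ℝ) → ℝ) (σ : SeqPolicy d M) (N : ℕ) :
    expectedEntropy ε p₀ σ N = entropy p₀ - ∑ n ∈ Finset.range N, ∑ h : History M n,
      historyProb ε p₀ σ n h * cycleLoss ε (posterior ε p₀ σ n h) (σ n h) := by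
  induction N with
  | zero => simp [expectedEntropy, historyProb, posterior]
  | succ n ih =>
    rw [Finset.sum_range_succ, ← sub_sub, ← ih, expectedEntropy, expectedEntropy,
      sum_eq_sum_snoc, ← Finset.sum_sub_distrib]
    refine Finset.sum_congr rfl fun h _ => ?_
    simp only [historyProb, posterior, Fin.init_snoc, Fin.snoc_last, mul_assoc, ← Finset.mul_sum,
      cycleLoss]
    ring

lemma expectedEntropy_sub (hε : ∀ m, ε m ∈ Set.Ioo (0 : ℝ) 1)
    (hσ : ∀ n h, (σ n h).IsMeasurable) (hp₀ : IsDensityOn 𝒳 p₀) (N : ℕ) (C : ℝ) :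
    expectedEntropy ε p₀ σ N - (entropy p₀ - N * C) = ∑ n ∈ Finset.range N, ∑ h : History M n,
      historyProb ε p₀ σ n h * (C - cycleLoss ε (posterior ε p₀ σ n h) (σ n h)) := by
  simp only [mul_sub, Finset.sum_sub_distrib, ← Finset.sum_mul, sum_historyProb hε hσ hp₀,
    expectedEntropy_eq, Finset.sum_const, Finset.card_range, nsmul_eq_mul]
  ring

lemma expectedEntropy_of_forall_cycleLoss_eq (hε : ∀ m, ε m ∈ Set.Ioo (0 : ℝ) 1)
    (hσ : ∀ n h, (σ n h).IsMeasurable) (hp₀ : IsDensityOn 𝒳 p₀) {N : ℕ} {C : ℝ}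
    (hloss : ∀ n < N, ∀ h, cycleLoss ε (posterior ε p₀ σ n h) (σ n h) = C) :
    expectedEntropy ε p₀ σ N = entropy p₀ - N * C := by
  rw [← sub_eq_zero, expectedEntropy_sub hε hσ hp₀]
  refine Finset.sum_eq_zero fun n hn => Finset.sum_eq_zero fun h _ => ?_
  rw [hloss n (Finset.mem_range.1 hn), sub_self, mul_zero]

lemma cycleLoss_eq_of_expectedEntropy_le (hε : ∀ m, ε m ∈ Set.Ioo (0 : ℝ) 1)
    (hσ : ∀ n h, (σ n h).IsMeasurable) (hp₀ : IsDensityOn 𝒳 p₀) (hH : HasFiniteEntropy p₀)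
    {N : ℕ} (hle : expectedEntropy ε p₀ σ N ≤ entropy p₀ - N * ∑ m, capacity (ε m)) {n : ℕ}
    (hn : n < N) (h : History M n) :
    cycleLoss ε (posterior ε p₀ σ n h) (σ n h) = ∑ m, capacity (ε m) := by
  have hterm (n : ℕ) (h : History M n) : 0 ≤ historyProb ε p₀ σ n h *
      (∑ m, capacity (ε m) - cycleLoss ε (posterior ε p₀ σ n h) (σ n h)) :=
    mul_nonneg (historyProb_pos hε hσ hp₀ n h).le <| sub_nonneg.2 <| cycleLoss_le hε (hσ n h)
      (isDominatedDensity_posterior hε hσ hp₀ n h).toIsDensityOn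
      (hasFiniteEntropy_posterior hε hσ hp₀ hH n h)
  rw [← sub_nonpos, expectedEntropy_sub hε hσ hp₀] at hle
  have hcycle := (Finset.sum_nonneg fun n _ => Finset.sum_nonneg fun h _ => hterm n h).antisymm' hle
  rw [Finset.sum_eq_zero_iff_of_nonneg fun n _ => Finset.sum_nonneg fun h _ => hterm n h] at hcycle
  have hzero := (Finset.sum_eq_zero_iff_of_nonneg fun h _ => hterm n h).1
    (hcycle n (Finset.mem_range.2 hn)) h (Finset.mem_univ h)
  exact (sub_eq_zero.1
    ((mul_eq_zero.1 hzero).resolve_left (historyProb_pos hε hσ hp₀ n h).ne')).symm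

end Posterior

/-- The posteriors that arise when the batch of each cycle `n` is a function `B n` of the current
posterior. -/
def markovPosterior (ε : Fin M → ℝ) (p₀ : (Fin d → ℝ) → ℝ)
    (B : ℕ → ((Fin d → ℝ) → ℝ) → Fin M → Set (Fin d → ℝ)) :
    (n : ℕ) → History M n → (Fin d → ℝ) → ℝ
  | 0, _ => p₀
  | n + 1, h =>
      bayes (markovPosterior ε p₀ B n (Fin.init h))
        (cycleLik ε (ofJoint (B n (markovPosterior ε p₀ B n (Fin.init h)))) (h (Fin.last n)))

/-- The joint policy that asks in each cycle `n` the batch `B n` of the current posterior. -/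
def markovPolicy (ε : Fin M → ℝ) (p₀ : (Fin d → ℝ) → ℝ)
    (B : ℕ → ((Fin d → ℝ) → ℝ) → Fin M → Set (Fin d → ℝ)) : JointPolicy d M :=
  fun n h => B n (markovPosterior ε p₀ B n h)

lemma posterior_markovPolicy (ε : Fin M → ℝ) (p₀ : (Fin d → ℝ) → ℝ)
    (B : ℕ → ((Fin d → ℝ) → ℝ) → Fin M → Set (Fin d → ℝ)) (n : ℕ) (h : History M n) :
    posterior ε p₀ (markovPolicy ε p₀ B).toSeq n h = markovPosterior ε p₀ B n h := by
  induction n with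
  | zero => rfl
  | succ n ih => rw [posterior, ih, markovPosterior, JointPolicy.toSeq, markovPolicy]

lemma exists_jointPolicy_forall_posterior (ε : Fin M → ℝ) (p₀ : (Fin d → ℝ) → ℝ)
    {P : ℕ → ((Fin d → ℝ) → ℝ) → (Fin M → Set (Fin d → ℝ)) → Prop} (hP : ∀ n q, ∃ A, P n q A) :
    ∃ ζ : JointPolicy d M, ∀ n h, P n (posterior ε p₀ ζ.toSeq n h) (ζ n h) := by
  choose B hB using hP
  refine ⟨markovPolicy ε p₀ B, fun n h => ?_⟩
  rw [posterior_markovPolicy]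
  exact hB n _

lemma SeqPolicy.Admissible.isMeasurable {J : ℕ → Fin M → ℕ} {σ : SeqPolicy d M}
    (hσ : σ.Admissible 𝒳 J) (n : ℕ) (h : History M n) : (σ n h).IsMeasurable :=
  SeqDesign.Admissible.isMeasurable (hσ n h)

lemma JointPolicy.Admissible.toSeq {J : ℕ → Fin M → ℕ} {ζ : JointPolicy d M}
    (hζ : ζ.Admissible 𝒳 J) : ζ.toSeq.Admissible 𝒳 J :=
  fun n h m _ => hζ n h m

lemma IsOptimalJointPolicy.cycleLoss_eq {J : ℕ → Fin M → ℕ} {N : ℕ} {ζ : JointPolicy d M}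
    (hd : 0 < d) (hε : ∀ m, ε m ∈ Set.Ioo (0 : ℝ) 1) (hp₀ : IsDensityOn 𝒳 p₀)
    (hH : HasFiniteEntropy p₀) (hζ : IsOptimalJointPolicy 𝒳 J ε p₀ N ζ)
    (hbatch : ∀ n q, IsDominatedDensity 𝒳 p₀ ((minLik ε)⁻¹ ^ n) q → HasFiniteEntropy q →
      ∃ A : Fin M → Set (Fin d → ℝ), (∀ m, IsQueryRegion 𝒳 (J n m) (A m)) ∧
        cycleLoss ε q (ofJoint A) = ∑ m, capacity (ε m))
    {n : ℕ} (hn : n < N) (h : History M n) :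
    cycleLoss ε (posterior ε p₀ ζ.toSeq n h) (ofJoint (ζ n h)) = ∑ m, capacity (ε m) := by
  have hchoice (n : ℕ) (q : (Fin d → ℝ) → ℝ) : ∃ A : Fin M → Set (Fin d → ℝ),
      (∀ m, IsQueryRegion 𝒳 (J n m) (A m)) ∧
        (IsDominatedDensity 𝒳 p₀ ((minLik ε)⁻¹ ^ n) q ∧ HasFiniteEntropy q →
          cycleLoss ε q (ofJoint A) = ∑ m, capacity (ε m)) := by
    by_cases hq : IsDominatedDensity 𝒳 p₀ ((minLik ε)⁻¹ ^ n) q ∧ HasFiniteEntropy q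
    · obtain ⟨A, hA, hloss⟩ := hbatch n q hq.1 hq.2
      exact ⟨A, hA, fun _ => hloss⟩
    · exact ⟨fun _ => ∅, fun m => .empty hd 𝒳 (J n m), fun h => absurd h hq⟩
  obtain ⟨ζ', hζ'⟩ := exists_jointPolicy_forall_posterior ε p₀ hchoice
  have hadm : ζ'.Admissible 𝒳 J := fun n h => (hζ' n h).1
  have hmeas' := hadm.toSeq.isMeasurable
  have hexp := expectedEntropy_of_forall_cycleLoss_eq (N := N) hε hmeas' hp₀ fun n _ h =>
    (hζ' n h).2 ⟨isDominatedDensity_posterior hε hmeas' hp₀ n h,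
      hasFiniteEntropy_posterior hε hmeas' hp₀ hH n h⟩
  exact cycleLoss_eq_of_expectedEntropy_le hε hζ.1.toSeq.isMeasurable hp₀ hH
    ((hζ.2 ζ' hadm).trans_eq hexp) hn h

end Policy

section EnoughRectangles

/-! ### Enough rectangles -/

variable {d M K : ℕ} {𝒳 Q : Set (Fin d → ℝ)} {p p₀ : (Fin d → ℝ) → ℝ} {κ : ℝ} {ε : Fin M → ℝ}
  {J : Fin M → ℕ} {A B : Fin M → Set (Fin d → ℝ)} {D : SeqDesign d M}

lemma IsOptimalBatch.cycleLoss_eq (hε : ∀ m, ε m ∈ Set.Ioo (0 : ℝ) 1) (hp : IsDensityOn 𝒳 p)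
    (hH : HasFiniteEntropy p) (hA : IsOptimalBatch 𝒳 J ε p A)
    (hB : ∀ m, IsQueryRegion 𝒳 (J m) (B m))
    (hloss : cycleLoss ε p (ofJoint B) = ∑ m, capacity (ε m)) :
    cycleLoss ε p (ofJoint A) = ∑ m, capacity (ε m) :=
  (cycleLoss_le hε (isMeasurable_ofJoint fun m => (hA.1 m).measurableSet) hp hH).antisymm
    (hloss.ge.trans (hA.2 B hB))

lemma exists_batch_cycleLoss_eq (hd : 0 < d) (hε : ∀ m, ε m ∈ Set.Ioo (0 : ℝ) 1)
    (hε2 : ∀ m, ε m ≠ 1 / 2) (hp : IsDensityOn 𝒳 p) (hH : HasFiniteEntropy p)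
    (hQ : IsQueryRegion 𝒳 K Q) (hmass : 1 - (2 : ℝ)⁻¹ ^ M ≤ mass p Q)
    (hJ : ∀ m, 2 ^ M * K ≤ J m) :
    ∃ A : Fin M → Set (Fin d → ℝ), (∀ m, IsQueryRegion 𝒳 (J m) (A m)) ∧
      cycleLoss ε p (ofJoint A) = ∑ m, capacity (ε m) := by
  obtain ⟨A, hA, hcell⟩ := exists_equalizing_batch hd hp hQ hmass
  exact ⟨A, fun m => (hA m).mono hd (hJ m),
    (cycleLoss_ofJoint_eq_iff hε hε2 (fun m => (hA m).measurableSet) hp hH).2 hcell⟩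

lemma IsGreedy.cycleLoss_eq (hd : 0 < d) (hε : ∀ m, ε m ∈ Set.Ioo (0 : ℝ) 1)
    (hε2 : ∀ m, ε m ≠ 1 / 2) (hp : IsDensityOn 𝒳 p) (hH : HasFiniteEntropy p)
    (hQ : IsQueryRegion 𝒳 K Q) (hmass : ∀ t w, 1 / 2 ≤ mass (subPosterior ε p D t w) Q)
    (hJ : ∀ m, K ≤ J m) (hD : IsGreedy 𝒳 J ε p D) :
    cycleLoss ε p D = ∑ m, capacity (ε m) := by
  refine cycleLoss_eq_of_isBisection hε hD.1.isMeasurable hp hH <|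
    hD.isBisection hε hε2 hp hH fun t w => ?_
  have hq := isDensityOn_subPosterior hε hD.1.isMeasurable hp t w
  obtain ⟨A, hA, hAmass⟩ :=
    exists_query_mass_eq hd hq.integrable hQ one_half_pos.le (hmass t w)
  exact ⟨A, hA.mono hd (hJ t), hAmass⟩

lemma admissible_ofJoint (hA : ∀ m, IsQueryRegion 𝒳 (J m) (A m)) : (ofJoint A).Admissible 𝒳 J :=
  fun m _ => hA m

lemma isGreatest_cycleLoss_ofJoint (hε : ∀ m, ε m ∈ Set.Ioo (0 : ℝ) 1) (hp : IsDensityOn 𝒳 p)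
    (hH : HasFiniteEntropy p) (hA : ∀ m, IsQueryRegion 𝒳 (J m) (A m))
    (hloss : cycleLoss ε p (ofJoint A) = ∑ m, capacity (ε m)) :
    IsGreatest {c | ∃ A : Fin M → Set (Fin d → ℝ), (∀ m, IsQueryRegion 𝒳 (J m) (A m)) ∧
      cycleLoss ε p (ofJoint A) = c} (∑ m, capacity (ε m)) := by
  refine ⟨⟨A, hA, hloss⟩, ?_⟩
  rintro _ ⟨B, hB, rfl⟩
  exact cycleLoss_le hε (admissible_ofJoint hB).isMeasurable hp hH

lemma isGreatest_cycleLoss (hε : ∀ m, ε m ∈ Set.Ioo (0 : ℝ) 1) (hp : IsDensityOn 𝒳 p)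
    (hH : HasFiniteEntropy p) (hD : D.Admissible 𝒳 J)
    (hloss : cycleLoss ε p D = ∑ m, capacity (ε m)) :
    IsGreatest {c | ∃ D : SeqDesign d M, D.Admissible 𝒳 J ∧ cycleLoss ε p D = c}
      (∑ m, capacity (ε m)) := by
  refine ⟨⟨D, hD, hloss⟩, ?_⟩
  rintro _ ⟨E, hE, rfl⟩
  exact cycleLoss_le hε hE.isMeasurable hp hH

lemma exists_isGreedy_isBisection (hε : ∀ m, ε m ∈ Set.Ioo (0 : ℝ) 1)
    (hε2 : ∀ m, ε m ≠ 1 / 2) (hp : IsDensityOn 𝒳 p) (hH : HasFiniteEntropy p)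
    (hD : D.Admissible 𝒳 J) (hloss : cycleLoss ε p D = ∑ m, capacity (ε m)) :
    ∃ E, IsGreedy 𝒳 J ε p E ∧ IsBisection ε p E :=
  have hbis := isBisection_of_cycleLoss_eq hε hε2 hD.isMeasurable hp hH hloss
  ⟨D, isGreedy_of_isBisection hε hp hH hD hbis, hbis⟩

lemma mass_eq_of_mem_dyadicPartition (hε : ∀ m, ε m ∈ Set.Ioo (0 : ℝ) 1)
    (hε2 : ∀ m, ε m ≠ 1 / 2) (hA : ∀ m, IsQueryRegion 𝒳 (J m) (A m)) (hp : IsDensityOn 𝒳 p)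
    (hH : HasFiniteEntropy p) (hloss : cycleLoss ε p (ofJoint A) = ∑ m, capacity (ε m)) :
    ∀ R ∈ dyadicPartition A, mass p R = (2 : ℝ)⁻¹ ^ M :=
  Set.forall_mem_range.2
    ((cycleLoss_ofJoint_eq_iff hε hε2 (fun m => (hA m).measurableSet) hp hH).1 hloss)

lemma IsDominatedDensity.subPosterior (hε : ∀ m, ε m ∈ Set.Ioo (0 : ℝ) 1) (hD : D.IsMeasurable)
    (hp : IsDominatedDensity 𝒳 p₀ κ p) (t : Fin M) (w : Fin t → Bool) :
    IsDominatedDensity 𝒳 p₀ ((minLik ε)⁻¹ * κ) (subPosterior ε p D t w) :=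
  hp.bayes (isLikelihood_prefixLik hε hD t t.isLt.le w)

/-- One region `Q` serves both claims: it captures almost all of `p` and of all posteriors that
can arise within the cycle. -/
lemma exists_forall_cycleLoss_eq (hd : 0 < d) (h𝒳 : volume (𝒳 \ interior 𝒳) = 0)
    (hp₀ : IsDensityOn 𝒳 p₀) (hε : ∀ m, ε m ∈ Set.Ioo (0 : ℝ) 1) (hε2 : ∀ m, ε m ≠ 1 / 2)
    (hκ : 0 < κ) :
    ∃ J₀ : ℕ, ∀ (J : Fin M → ℕ), (∀ m, J₀ ≤ J m) → ∀ p, IsDominatedDensity 𝒳 p₀ κ p →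
      HasFiniteEntropy p →
        (∃ A : Fin M → Set (Fin d → ℝ), (∀ m, IsQueryRegion 𝒳 (J m) (A m)) ∧
          cycleLoss ε p (ofJoint A) = ∑ m, capacity (ε m)) ∧
        ∀ D, IsGreedy 𝒳 J ε p D → cycleLoss ε p D = ∑ m, capacity (ε m) := by
  have hκ' : 0 < (minLik ε)⁻¹ * κ := mul_pos (inv_pos.2 (minLik_pos hε)) hκ
  obtain ⟨K, Q, hQ, hmass⟩ := exists_isQueryRegion_forall_mass_ge h𝒳 hp₀ hκ'
    (η := (2 : ℝ)⁻¹ ^ M) (by positivity)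
  refine ⟨2 ^ M * K, fun J hJ p hp hH =>
    ⟨exists_batch_cycleLoss_eq hd hε hε2 hp.toIsDensityOn hH hQ (hmass p ?_) hJ, fun D hD =>
      hD.cycleLoss_eq hd hε hε2 hp.toIsDensityOn hH hQ (fun t w => ?_)
        fun m => (Nat.le_mul_of_pos_left K (by positivity)).trans (hJ m)⟩⟩
  · exact hp.mono hp₀ (le_mul_of_one_le_left hκ.le
      ((one_le_inv₀ (minLik_pos hε)).2 (minLik_le_one hε)))
  · have hpow : (2 : ℝ)⁻¹ ^ M ≤ 2⁻¹ :=
      pow_le_of_le_one (by norm_num) (by norm_num) (Fin.pos t).ne'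
    linarith [hmass _ (hp.subPosterior hε hD.1.isMeasurable t w)]

end EnoughRectangles

end TwentyQuestions

end

open TwentyQuestions in
theorem theorem2_general {d M : ℕ} (hd : 0 < d)
    (𝒳 : Set (Fin d → ℝ)) (h𝒳 : volume (𝒳 \ interior 𝒳) = 0)
    (p₀ : (Fin d → ℝ) → ℝ) (hp₀ : IsDensityOn 𝒳 p₀) (hH : HasFiniteEntropy p₀)
    (ε : Fin M → ℝ) (hε : ∀ m, ε m ∈ Set.Ioo (0 : ℝ) 1)
    (hε2 : ∀ m, ε m ≠ 1 / 2) :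
    (∀ (J : ℕ → Fin M → ℕ) (σ : SeqPolicy d M), σ.Admissible 𝒳 J →
      ∀ (n : ℕ) (h : History M n),
        IsDensityOn 𝒳 (posterior ε p₀ σ n h) ∧ HasFiniteEntropy (posterior ε p₀ σ n h) ∧
        (∀ D : SeqDesign d M, D.Admissible 𝒳 (J n) → IsBisection ε (posterior ε p₀ σ n h) D →
          cycleLoss ε (posterior ε p₀ σ n h) D = ∑ m, capacity (ε m)) ∧
        (∀ A : Fin M → Set (Fin d → ℝ), (∀ m, IsQueryRegion 𝒳 (J n m) (A m)) →
          cycleLoss ε (posterior ε p₀ σ n h) (ofJoint A) ≤ ∑ m, capacity (ε m) ∧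
          (cycleLoss ε (posterior ε p₀ σ n h) (ofJoint A) = ∑ m, capacity (ε m) →
            ∀ R ∈ dyadicPartition A, mass (posterior ε p₀ σ n h) R = (2 : ℝ)⁻¹ ^ M))) ∧
    ∃ J₀ : ℕ → ℕ, ∀ J : ℕ → Fin M → ℕ, (∀ n m, J₀ n ≤ J n m) →
      (∀ σ : SeqPolicy d M, σ.Admissible 𝒳 J → ∀ (n : ℕ) (h : History M n),
        IsGreatest {c | ∃ A : Fin M → Set (Fin d → ℝ), (∀ m, IsQueryRegion 𝒳 (J n m) (A m)) ∧
          cycleLoss ε (posterior ε p₀ σ n h) (ofJoint A) = c} (∑ m, capacity (ε m)) ∧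
        IsGreatest {c | ∃ D : SeqDesign d M, D.Admissible 𝒳 (J n) ∧
          cycleLoss ε (posterior ε p₀ σ n h) D = c} (∑ m, capacity (ε m)) ∧
        (∃ D : SeqDesign d M, IsGreedy 𝒳 (J n) ε (posterior ε p₀ σ n h) D ∧
          IsBisection ε (posterior ε p₀ σ n h) D) ∧
        (∀ D : SeqDesign d M, IsGreedy 𝒳 (J n) ε (posterior ε p₀ σ n h) D →
          cycleLoss ε (posterior ε p₀ σ n h) D = ∑ m, capacity (ε m)) ∧
        (∀ A : Fin M → Set (Fin d → ℝ), IsOptimalBatch 𝒳 (J n) ε (posterior ε p₀ σ n h) A →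
          ∀ R ∈ dyadicPartition A, mass (posterior ε p₀ σ n h) R = (2 : ℝ)⁻¹ ^ M)) ∧
      (∀ (N : ℕ) (ζ : JointPolicy d M), IsOptimalJointPolicy 𝒳 J ε p₀ N ζ →
        ∀ n < N, ∀ h : History M n,
          cycleLoss ε (posterior ε p₀ ζ.toSeq n h) (ofJoint (ζ n h)) = ∑ m, capacity (ε m) ∧
          ∀ R ∈ dyadicPartition (ζ n h),
            mass (posterior ε p₀ ζ.toSeq n h) R = (2 : ℝ)⁻¹ ^ M) := by
  have hdom {J : ℕ → Fin M → ℕ} {σ : SeqPolicy d M} (hσ : σ.Admissible 𝒳 J) :=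
    isDominatedDensity_posterior hε hσ.isMeasurable hp₀
  have hent {J : ℕ → Fin M → ℕ} {σ : SeqPolicy d M} (hσ : σ.Admissible 𝒳 J) :=
    hasFiniteEntropy_posterior hε hσ.isMeasurable hp₀ hH
  choose J₀ hJ₀ using fun n => exists_forall_cycleLoss_eq hd h𝒳 hp₀ hε hε2
    (pow_pos (inv_pos.2 (minLik_pos hε)) n)
  refine ⟨fun J σ hσ n h => ?_, J₀, fun J hJ => ⟨fun σ hσ n h => ?_, fun N ζ hζ n hn h => ?_⟩⟩
  · have hp := (hdom hσ n h).toIsDensityOn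
    have hpH := hent hσ n h
    exact ⟨hp, hpH, fun D hD => cycleLoss_eq_of_isBisection hε hD.isMeasurable hp hpH,
      fun A hA => ⟨cycleLoss_le hε (admissible_ofJoint hA).isMeasurable hp hpH,
        mass_eq_of_mem_dyadicPartition hε hε2 hA hp hpH⟩⟩
  · have hp := (hdom hσ n h).toIsDensityOn
    have hpH := hent hσ n h
    obtain ⟨⟨A, hA, hloss⟩, hgreedy⟩ := hJ₀ n (J n) (hJ n) _ (hdom hσ n h) hpH
    exact ⟨isGreatest_cycleLoss_ofJoint hε hp hpH hA hloss,
      isGreatest_cycleLoss hε hp hpH (admissible_ofJoint hA) hloss,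
      exists_isGreedy_isBisection hε hε2 hp hpH (admissible_ofJoint hA) hloss, hgreedy,
      fun B hB => mass_eq_of_mem_dyadicPartition hε hε2 hB.1 hp hpH
        (hB.cycleLoss_eq hε hp hpH hA hloss)⟩
  · have hloss := hζ.cycleLoss_eq hd hε hp₀ hH
      (fun n q hq hqH => (hJ₀ n (J n) (hJ n) q hq hqH).1) hn h
    exact ⟨hloss, mass_eq_of_mem_dyadicPartition hε hε2 (hζ.1 n h)
      (hdom hζ.1.toSeq n h).toIsDensityOn (hent hζ.1.toSeq n h) hloss⟩

open TwentyQuestions in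
theorem theorem2 {d M : ℕ} (hd : 0 < d)
    (𝒳 : Set (Fin d → ℝ)) (h𝒳 : volume (𝒳 \ interior 𝒳) = 0)
    (p₀ : (Fin d → ℝ) → ℝ) (hp₀ : IsDensityOn 𝒳 p₀) (hH : HasFiniteEntropy p₀)
    (ε : Fin M → ℝ) (hε : ∀ m, ε m ∈ Set.Ioo (0 : ℝ) (1 / 2)) :
    -- whatever the bounds `J` on the numbers of rectangles:
    (∀ (J : ℕ → Fin M → ℕ) (σ : SeqPolicy d M), σ.Admissible 𝒳 J →
      ∀ (n : ℕ) (h : History M n),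
        IsDensityOn 𝒳 (posterior ε p₀ σ n h) ∧ HasFiniteEntropy (posterior ε p₀ σ n h) ∧
        (∀ D : SeqDesign d M, D.Admissible 𝒳 (J n) → IsBisection ε (posterior ε p₀ σ n h) D →
          cycleLoss ε (posterior ε p₀ σ n h) D = ∑ m, capacity (ε m)) ∧
        (∀ A : Fin M → Set (Fin d → ℝ), (∀ m, IsQueryRegion 𝒳 (J n m) (A m)) →
          cycleLoss ε (posterior ε p₀ σ n h) (ofJoint A) ≤ ∑ m, capacity (ε m) ∧
          (cycleLoss ε (posterior ε p₀ σ n h) (ofJoint A) = ∑ m, capacity (ε m) →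
            ∀ R ∈ dyadicPartition A, mass (posterior ε p₀ σ n h) R = (2 : ℝ)⁻¹ ^ M))) ∧
    -- whenever enough rectangles are allowed:
    ∃ J₀ : ℕ → ℕ, ∀ J : ℕ → Fin M → ℕ, (∀ n m, J₀ n ≤ J n m) →
      (∀ σ : SeqPolicy d M, σ.Admissible 𝒳 J → ∀ (n : ℕ) (h : History M n),
        -- the optimal joint design loses `C`
        IsGreatest {c | ∃ A : Fin M → Set (Fin d → ℝ), (∀ m, IsQueryRegion 𝒳 (J n m) (A m)) ∧
          cycleLoss ε (posterior ε p₀ σ n h) (ofJoint A) = c} (∑ m, capacity (ε m)) ∧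
        -- the optimal sequential design loses `C`
        IsGreatest {c | ∃ D : SeqDesign d M, D.Admissible 𝒳 (J n) ∧
          cycleLoss ε (posterior ε p₀ σ n h) D = c} (∑ m, capacity (ε m)) ∧
        -- there is a greedy sequential design that consists of bisections
        (∃ D : SeqDesign d M, IsGreedy 𝒳 (J n) ε (posterior ε p₀ σ n h) D ∧
          IsBisection ε (posterior ε p₀ σ n h) D) ∧
        -- every greedy sequential design loses `C`
        (∀ D : SeqDesign d M, IsGreedy 𝒳 (J n) ε (posterior ε p₀ σ n h) D →
          cycleLoss ε (posterior ε p₀ σ n h) D = ∑ m, capacity (ε m)) ∧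
        -- every jointly optimal batch equalizes the posterior over its dyadic partition
        (∀ A : Fin M → Set (Fin d → ℝ), IsOptimalBatch 𝒳 (J n) ε (posterior ε p₀ σ n h) A →
          ∀ R ∈ dyadicPartition A, mass (posterior ε p₀ σ n h) R = (2 : ℝ)⁻¹ ^ M)) ∧
      -- every optimal joint policy loses `C` in each cycle, and equalizes
      (∀ (N : ℕ) (ζ : JointPolicy d M), IsOptimalJointPolicy 𝒳 J ε p₀ N ζ →
        ∀ n < N, ∀ h : History M n,
          cycleLoss ε (posterior ε p₀ ζ.toSeq n h) (ofJoint (ζ n h)) = ∑ m, capacity (ε m) ∧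
          ∀ R ∈ dyadicPartition (ζ n h),
            mass (posterior ε p₀ ζ.toSeq n h) R = (2 : ℝ)⁻¹ ^ M) :=
  theorem2_general hd 𝒳 h𝒳 p₀ hp₀ hH ε
    (fun m => ⟨(hε m).1, (hε m).2.trans one_half_lt_one⟩) fun m => (hε m).2.ne
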